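/- **Theorem 6.6 (Bohr–Sommerfeld inequalities).** Let $V:\mathbb{R}\to[0,\infty)$ be a single-well potential, i.e. $V$ is continuous, $V(0)=0$, $V$ is strictly increasing on $[0,\infty)$ and strictly decreasing on $(-\infty,0]$, and $V(x)\to+\infty$ as $x\to\pm\infty$. Let $\mathcal{H}[V]$ be the closure in $L^2(\mathbb{R})$ of the operator $-\partial_x^2+V$ with domain $C_c^\infty(\mathbb{R})$ (which is its unique self-adjoint extension). Then the eigenvalues of $\mathcal{H}[V]$ form a strictly increasing sequence $E_1<E_2<\cdots$ diverging to $+\infty$, and, writing $|A|$ for the Lebesgue measure of $A\subseteq\mathbb{R}$ and $\{V<c\}=\{x\in\mathbb{R}:V(x)<c\}$, $$\sqrt{E_1}\,\bigl|\{V<\varepsilon^{-2}E_1\}\bigr|\ \ge\ \tfrac{4}{27}(1-\varepsilon)^3\pi\qquad\text{for all }\varepsilon\in(0,1),$$ $$\sqrt{E_n}\,\bigl|\{V<E_n\}\bigr|\ \ge\ \pi(n-1)\qquad\text{for all integers }n\ge1,$$ $$\sqrt{\frac{E_n}{1+t}}\,\left|\left\{V<\frac{E_n}{1+t}\right\}\right|\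 \le\ \frac{\pi n}{\sqrt t}\qquad\text{for all integers }n\ge1\text{ and all }t>0.$$ -/

import Mathlib

open MeasureTheory Filter Topology

/-- The class of single-well potentials: continuous nonnegative functions on the line, vanishing
at `0`, strictly increasing on `[0, ∞)`, strictly decreasing on `(-∞, 0]`, and tending to `+∞`
at both ends. -/
structure IsSingleWell (V : ℝ → ℝ) : Prop where
  continuous : Continuous V
  nonneg : ∀ x, 0 ≤ V x
  zero : V 0 = 0
  strictMonoOn : StrictMonoOn V (Set.Ici 0)
  strictAntiOn : StrictAntiOn V (Set.Iic 0)
  tendsto_atTop : Tendsto V atTop atTop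
  tendsto_atBot : Tendsto V atBot atTop

/-- The complex Hilbert space `L²(ℝ)` with respect to Lebesgue measure. -/
abbrev L2Line : Type := Lp ℂ 2 (volume : Measure ℝ)

/-- Smooth compactly supported complex-valued functions on the line. -/
def IsTestFunction (φ : ℝ → ℂ) : Prop :=
  ContDiff ℝ (⊤ : ℕ∞) φ ∧ HasCompactSupport φ

/-- The differential expression `-φ'' + V φ`. -/
noncomputable def schrodingerExpr (V : ℝ → ℝ) (φ : ℝ → ℂ) (x : ℝ) : ℂ :=
  -(deriv (deriv φ) x) + (V x : ℂ) * φ x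

theorem IsTestFunction.differentiable {φ : ℝ → ℂ} (h : IsTestFunction φ) :
    Differentiable ℝ φ :=
  h.1.differentiable (by simp)

theorem IsTestFunction.derivTest {φ : ℝ → ℂ} (h : IsTestFunction φ) : IsTestFunction (deriv φ) :=
  ⟨((contDiff_succ_iff_deriv (n := ((⊤ : ℕ∞) : WithTop ℕ∞))).1 (by simpa using h.1)).2.2,
    h.2.deriv⟩

theorem IsTestFunction.add {φ χ : ℝ → ℂ} (h : IsTestFunction φ) (k : IsTestFunction χ) :
    IsTestFunction (φ + χ) :=
  ⟨h.1.add k.1, h.2.add k.2⟩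

theorem IsTestFunction.const_smul {φ : ℝ → ℂ} (c : ℂ) (h : IsTestFunction φ) :
    IsTestFunction (c • φ) :=
  ⟨h.1.const_smul c, h.2.mono (by
    intro x hx hφ
    exact hx (by simp [hφ]))⟩

theorem schrodingerExpr_add (V : ℝ → ℝ) {φ χ : ℝ → ℂ} (h : IsTestFunction φ)
    (k : IsTestFunction χ) :
    schrodingerExpr V (φ + χ) = schrodingerExpr V φ + schrodingerExpr V χ := by
  have h1 : deriv (φ + χ) = deriv φ + deriv χ := by
    funext x; exact deriv_add (h.differentiable x) (k.differentiable x)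
  have h2 : deriv (deriv φ + deriv χ) = deriv (deriv φ) + deriv (deriv χ) := by
    funext x; exact deriv_add (h.derivTest.differentiable x) (k.derivTest.differentiable x)
  funext x
  simp only [schrodingerExpr, h1, h2, Pi.add_apply]
  ring

theorem schrodingerExpr_smul (V : ℝ → ℝ) (c : ℂ) (φ : ℝ → ℂ) :
    schrodingerExpr V (c • φ) = c • schrodingerExpr V φ := by
  have h1 : ∀ f : ℝ → ℂ, deriv (c • f) = c • deriv f := by
    intro f; funext x; exact deriv_const_smul_field c f
  funext x
  simp only [schrodingerExpr, h1, Pi.smul_apply, smul_eq_mul]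
  ring

/-- The graph of `-∂ₓ² + V` with domain `C_c^∞(ℝ)`, inside `L²(ℝ) × L²(ℝ)`. -/
noncomputable def minimalGraph (V : ℝ → ℝ) : Submodule ℂ (L2Line × L2Line) where
  carrier := {p | ∃ φ : ℝ → ℂ, IsTestFunction φ ∧
    (p.1 : ℝ → ℂ) =ᵐ[volume] φ ∧ (p.2 : ℝ → ℂ) =ᵐ[volume] schrodingerExpr V φ}
  add_mem' := by
    rintro p q ⟨φ, h, hp1, hp2⟩ ⟨χ, k, hq1, hq2⟩
    refine ⟨φ + χ, h.add k, (Lp.coeFn_add p.1 q.1).trans (hp1.add hq1), ?_⟩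
    rw [schrodingerExpr_add V h k]
    exact (Lp.coeFn_add p.2 q.2).trans (hp2.add hq2)
  zero_mem' := by
    refine ⟨0, ⟨contDiff_const, HasCompactSupport.zero⟩, Lp.coeFn_zero ℂ 2 volume, ?_⟩
    have h0 : schrodingerExpr V 0 = 0 := by
      have := schrodingerExpr_smul V 0 0
      simpa using this
    rw [h0]
    exact Lp.coeFn_zero ℂ 2 volume
  smul_mem' := by
    rintro c p ⟨φ, h, hp1, hp2⟩
    refine ⟨c • φ, h.const_smul c, (Lp.coeFn_smul c p.1).trans (hp1.const_smul c), ?_⟩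
    rw [schrodingerExpr_smul]
    exact (Lp.coeFn_smul c p.2).trans (hp2.const_smul c)

/-- `minimalGraph V` is the graph of a single-valued operator. -/
theorem minimalGraph_single_valued (V : ℝ → ℝ) (p : L2Line × L2Line) (hp : p ∈ minimalGraph V)
    (h0 : p.1 = 0) : p.2 = 0 := by
  obtain ⟨φ, h, hp1, hp2⟩ := hp
  have hφ : φ = 0 := by
    have h1 : φ =ᵐ[volume] (0 : ℝ → ℂ) :=
      hp1.symm.trans (by rw [h0]; exact Lp.coeFn_zero ℂ 2 volume)
    exact Measure.eq_of_ae_eq h1 h.1.continuous continuous_const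
  have hz : schrodingerExpr V 0 = 0 := by
    have := schrodingerExpr_smul V 0 0
    simpa using this
  subst hφ
  rw [hz] at hp2
  exact (Lp.eq_zero_iff_ae_eq_zero).2 hp2

/-- The operator `-∂ₓ² + V` in `L²(ℝ)` with domain `C_c^∞(ℝ)`. -/
noncomputable def minimalOperator (V : ℝ → ℝ) : L2Line →ₗ.[ℂ] L2Line :=
  (minimalGraph V).toLinearPMap

theorem minimalOperator_graph (V : ℝ → ℝ) : (minimalOperator V).graph = minimalGraph V :=
  Submodule.toLinearPMap_graph_eq _ (minimalGraph_single_valued V)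

theorem IsTestFunction.continuous_schrodingerExpr {V : ℝ → ℝ} (hV : Continuous V) {φ : ℝ → ℂ}
    (h : IsTestFunction φ) : Continuous (schrodingerExpr V φ) := by
  have h1 := h.derivTest.derivTest.1.continuous
  have h2 := h.1.continuous
  unfold schrodingerExpr
  fun_prop

theorem IsTestFunction.hasCompactSupport_schrodingerExpr (V : ℝ → ℝ) {φ : ℝ → ℂ}
    (h : IsTestFunction φ) : HasCompactSupport (schrodingerExpr V φ) :=
  (h.derivTest.derivTest.2.neg).add (h.2.mul_left (f := fun x => (V x : ℂ)))

/-- Every test function lies in the domain of the minimal operator. -/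
theorem IsTestFunction.mem_minimalGraph {V : ℝ → ℝ} (hV : Continuous V) {φ : ℝ → ℂ}
    (h : IsTestFunction φ) :
    ((h.1.continuous.memLp_of_hasCompactSupport h.2).toLp φ,
      ((h.continuous_schrodingerExpr hV).memLp_of_hasCompactSupport
        (h.hasCompactSupport_schrodingerExpr V)).toLp (schrodingerExpr V φ)) ∈ minimalGraph V :=
  ⟨φ, h, (h.1.continuous.memLp_of_hasCompactSupport h.2).coeFn_toLp,
    ((h.continuous_schrodingerExpr hV).memLp_of_hasCompactSupport
      (h.hasCompactSupport_schrodingerExpr V)).coeFn_toLp⟩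

theorem IsTestFunction.integral_deriv_deriv {φ χ : ℝ → ℂ} (h : IsTestFunction φ)
    (k : IsTestFunction χ) :
    ∫ x, φ x * deriv (deriv χ) x = ∫ x, deriv (deriv φ) x * χ x := by
  have key : ∀ {u v : ℝ → ℂ}, IsTestFunction u → IsTestFunction v →
      ∫ x, u x * deriv v x = - ∫ x, deriv u x * v x := by
    intro u v hu hv
    exact integral_mul_deriv_eq_deriv_mul_of_integrable
      (fun x _ => (hu.differentiable x).hasDerivAt) (fun x _ => (hv.differentiable x).hasDerivAt)
      ((hu.1.continuous.mul hv.derivTest.1.continuous).integrable_of_hasCompactSupport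
        hv.derivTest.2.mul_left)
      ((hu.derivTest.1.continuous.mul hv.1.continuous).integrable_of_hasCompactSupport hv.2.mul_left)
      ((hu.1.continuous.mul hv.1.continuous).integrable_of_hasCompactSupport hv.2.mul_left)
  rw [key h k.derivTest, key h.derivTest k, neg_neg]

theorem IsTestFunction.integral_schrodingerExpr {V : ℝ → ℝ} (hV : Continuous V) {φ χ : ℝ → ℂ}
    (h : IsTestFunction φ) (k : IsTestFunction χ) :
    ∫ x, schrodingerExpr V χ x * φ x = ∫ x, χ x * schrodingerExpr V φ x := by
  have h2 := h.integral_deriv_deriv k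
  have cV : Continuous fun x => (V x : ℂ) := by fun_prop
  have i0 : Integrable fun x => (V x : ℂ) * χ x * φ x :=
    ((cV.mul k.1.continuous).mul h.1.continuous).integrable_of_hasCompactSupport h.2.mul_left
  have i1 : Integrable fun x => φ x * deriv (deriv χ) x :=
    (h.1.continuous.mul k.derivTest.derivTest.1.continuous).integrable_of_hasCompactSupport
      k.derivTest.derivTest.2.mul_left
  have i2 : Integrable fun x => deriv (deriv φ) x * χ x :=
    (h.derivTest.derivTest.1.continuous.mul k.1.continuous).integrable_of_hasCompactSupport k.2.mul_left
  have e1 : ∀ x, schrodingerExpr V χ x * φ x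
      = (V x : ℂ) * χ x * φ x - φ x * deriv (deriv χ) x := by
    intro x; simp only [schrodingerExpr]; ring
  have e2 : ∀ x, χ x * schrodingerExpr V φ x
      = (V x : ℂ) * χ x * φ x - deriv (deriv φ) x * χ x := by
    intro x; simp only [schrodingerExpr]; ring
  simp_rw [e1, e2]
  rw [integral_sub i0 i1, integral_sub i0 i2, h2]

/-- The minimal operator is closable, so that `schrodingerOperator V` is a genuine closure. -/
theorem minimalOperator_isClosable {V : ℝ → ℝ} (hV : Continuous V) :
    (minimalOperator V).IsClosable := by
  have hsv : ∀ p ∈ (minimalGraph V).topologicalClosure, p.1 = 0 → p.2 = 0 := by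
    intro p hp hp0
    rw [Lp.eq_zero_iff_ae_eq_zero]
    refine ae_eq_zero_of_integral_contDiff_smul_eq_zero
      ((Lp.memLp p.2).locallyIntegrable (by norm_num)) ?_
    intro g hg hgc
    have k : IsTestFunction fun x => (g x : ℂ) :=
      ⟨Complex.ofRealCLM.contDiff.comp hg, hgc.comp_left (g := fun y : ℝ => (y : ℂ)) (by simp)⟩
    set χ : ℝ → ℂ := fun x => (g x : ℂ) with hχ
    have kL := k.1.continuous.memLp_of_hasCompactSupport (μ := volume) (p := 2) k.2
    have kH := (k.continuous_schrodingerExpr hV).memLp_of_hasCompactSupport (μ := volume) (p := 2)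
      (k.hasCompactSupport_schrodingerExpr V)
    have hreal : ∀ x, (starRingEnd ℂ) (schrodingerExpr V χ x) = schrodingerExpr V χ x := by
      have d1 : ∀ {f : ℝ → ℝ}, Differentiable ℝ f →
          deriv (fun x => (f x : ℂ)) = fun x => ((deriv f x : ℝ) : ℂ) := by
        intro f hf; funext x; exact (hf x).hasDerivAt.ofReal_comp.deriv
      have hg1 : Differentiable ℝ g := hg.differentiable (by simp)
      have hg2 : Differentiable ℝ (deriv g) :=
        (((contDiff_succ_iff_deriv (n := ((⊤ : ℕ∞) : WithTop ℕ∞))).1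
          (by simpa using hg)).2.2).differentiable (by simp)
      intro x
      simp only [schrodingerExpr, hχ, d1 hg1, d1 hg2]
      simp
    have hzero : ∀ q ∈ (minimalGraph V).topologicalClosure,
        inner ℂ (kL.toLp χ) q.2 - inner ℂ (kH.toLp (schrodingerExpr V χ)) q.1 = 0 := by
      intro q hq
      have hcl : IsClosed {q : L2Line × L2Line |
          inner ℂ (kL.toLp χ) q.2 - inner ℂ (kH.toLp (schrodingerExpr V χ)) q.1 = 0} :=
        isClosed_eq (by fun_prop) continuous_const
      refine closure_minimal ?_ hcl hq
      rintro q ⟨φ, h, hq1, hq2⟩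
      have a1 : inner ℂ (kL.toLp χ) q.2 = ∫ x, χ x * schrodingerExpr V φ x := by
        rw [L2.inner_def]
        refine integral_congr_ae ?_
        filter_upwards [hq2, kL.coeFn_toLp] with x hx hx'
        rw [hx, hx']
        simp [hχ, mul_comm]
      have a2 : inner ℂ (kH.toLp (schrodingerExpr V χ)) q.1
          = ∫ x, schrodingerExpr V χ x * φ x := by
        rw [L2.inner_def]
        refine integral_congr_ae ?_
        filter_upwards [hq1, kH.coeFn_toLp] with x hx hx'
        rw [hx, hx']
        simp [hreal, mul_comm]
      simp only [Set.mem_ofPred_eq]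
      rw [a1, a2, h.integral_schrodingerExpr hV k, sub_self]
    have hp' := hzero p hp
    rw [hp0, inner_zero_right, sub_zero, L2.inner_def] at hp'
    rw [← hp']
    refine integral_congr_ae ?_
    filter_upwards [kL.coeFn_toLp] with x hx
    rw [hx]
    simp [hχ, mul_comm]
  refine ⟨(minimalGraph V).topologicalClosure.toLinearPMap, ?_⟩
  rw [minimalOperator_graph]
  exact (Submodule.toLinearPMap_graph_eq _ hsv).symm

/-- The Schrödinger operator `H[V]`: the closure of `-∂ₓ² + V` defined on `C_c^∞(ℝ)`. The latter
being essentially self-adjoint for the potentials considered here, the closure is its unique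
self-adjoint extension. -/
noncomputable def schrodingerOperator (V : ℝ → ℝ) : L2Line →ₗ.[ℂ] L2Line :=
  (minimalOperator V).closure

/-- The set of (real) eigenvalues of `H[V]`. -/
def schrodingerEigenvalues (V : ℝ → ℝ) : Set ℝ :=
  {E | ∃ ψ : (schrodingerOperator V).domain,
    (ψ : L2Line) ≠ 0 ∧ schrodingerOperator V ψ = (E : ℂ) • (ψ : L2Line)}

/-- `E 1 < E 2 < ...` is the increasing, divergent enumeration of all the eigenvalues of `H[V]`. -/
structure IsEigenvalueSequence (V : ℝ → ℝ) (E : ℕ+ → ℝ) : Prop where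
  strictMono : StrictMono E
  range_eq : Set.range E = schrodingerEigenvalues V
  tendsto : Tendsto E atTop atTop

/-! Write a real solution of `-u'' + V u = E u` in polar form `u = r sin θ`, `u' = r cos θ`. The
angle obeys the first-order equation `θ' = cos² θ + (E - V) sin² θ`, and everything is read off from
how far `θ` turns. Where `E ≤ V`, square integrability forces `u u'` to have the decaying sign, so
`θ` stays in one quadrant on each tail. After adding a multiple of `π` it runs from `[0, π/2]` to
`[nπ - π/2, nπ]`; this is `IsBoundState`, with rotation number `n`.

Each `n ≥ 1` has exactly one energy. Existence (`exists_isBoundState`) comes from shooting on `[-L,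
L]` and a compactness limit `L → ∞`; uniqueness and ordering (`IsBoundState.lt_of_energy_lt`,
`IsBoundState.rotation_unique`) come from the Wronskian.

For the inequalities, replace `θ` by the angle `φ` with `tan φ = k tan θ` (`scaledAngle`), which
fixes multiples of `π/2` and satisfies `φ' ≤ k` where `E - V ≤ k²` and `φ' ≥ k` where `E - V ≥ k²`.
With `k = √E` on `{V < E}` the turning is at least `(n-1)π`. With `k² = tE/(1+t)` on `{V < E/(1+t)}`
it is at most `nπ`. For the ground state on `{V < ε⁻²E}`, decay outside the interval gives `sin φ ≤
ε` at both ends, hence a turning of at least `π(1-ε)`, which is stronger than required.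

The operator enters through `mem_schrodingerEigenvalues_iff_isBoundState`. Square-integrable
solutions lie in the closure by cutoff and mollification. Conversely, by symmetry an eigenvector is
a weak solution, and `exists_linear_comb_of_mem_closure` shows that it is a classical one. -/

/-! ### The Prüfer equation: comparison, symmetries and barriers -/

/-- A function whose derivative is at most `K` times its value wherever it is positive
stays nonpositive once it is nonpositive. -/
theorem nonpos_of_deriv_le_mul {g g' : ℝ → ℝ} {K a b : ℝ} (hab : a ≤ b)
    (hg : ∀ x, HasDerivAt g (g' x) x) (hK : ∀ x ∈ Set.Icc a b, 0 < g x → g' x ≤ K * g x)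
    (ha : g a ≤ 0) : g b ≤ 0 := by
  by_contra! hb
  have hc : Continuous g := continuous_iff_continuousAt.2 fun x => (hg x).continuousAt
  obtain ⟨c, ⟨⟨hac, hcb⟩, hgc⟩, hmax⟩ :=
    (isCompact_Icc.inter_right (isClosed_le hc continuous_const)
      : IsCompact (Set.Icc a b ∩ {x | g x ≤ 0})).exists_isGreatest ⟨a, ⟨le_rfl, hab⟩, ha⟩
  have hgc' : g c ≤ 0 := hgc
  have hcb' : c < b := lt_of_le_of_ne hcb (by rintro rfl; linarith)
  have hd : ∀ x, HasDerivAt (fun x => g x * Real.exp (-(K * x)))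
      ((g' x - K * g x) * Real.exp (-(K * x))) x := by
    intro x
    have := (hg x).mul (((hasDerivAt_id x).const_mul K).neg.exp)
    convert! this using 1
    simp only [id, Pi.neg_apply]
    ring
  have hanti : AntitoneOn (fun x => g x * Real.exp (-(K * x))) (Set.Icc c b) := by
    refine antitoneOn_of_deriv_nonpos (convex_Icc c b)
      (fun x _ => (hd x).continuousAt.continuousWithinAt)
      (fun x _ => (hd x).differentiableAt.differentiableWithinAt) ?_
    intro x hx
    rw [interior_Icc] at hx
    rw [(hd x).deriv]
    have hpos : 0 < g x := by
      by_contra! h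
      exact absurd (hmax ⟨⟨hac.trans hx.1.le, hx.2.le⟩, h⟩) (not_le.2 hx.1)
    have := hK x ⟨hac.trans hx.1.le, hx.2.le⟩ hpos
    exact mul_nonpos_of_nonpos_of_nonneg (by linarith) (Real.exp_pos _).le
  have h1 := hanti ⟨le_rfl, hcb⟩ ⟨hcb, le_rfl⟩ hcb
  simp only at h1
  have h2 : 0 < g b * Real.exp (-(K * b)) := mul_pos hb (Real.exp_pos _)
  have h3 : g c * Real.exp (-(K * c)) ≤ 0 :=
    mul_nonpos_of_nonpos_of_nonneg hgc' (Real.exp_pos _).le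
  linarith

/-- The right-hand side of the Prüfer equation at energy `E`. -/
noncomputable def pruferField (V : ℝ → ℝ) (E x y : ℝ) : ℝ :=
  Real.cos y ^ 2 + (E - V x) * Real.sin y ^ 2

/-- `θ` is a Prüfer angle for `-u'' + V u = E u`. -/
def IsPruferAngle (V : ℝ → ℝ) (E : ℝ) (θ : ℝ → ℝ) : Prop :=
  ∀ x, HasDerivAt θ (pruferField V E x (θ x)) x

/-- Since `cos² = 1 - sin²`, the field equals `1 + (E - V - 1) sin²`, so its Lipschitz constant in
the angle is controlled locally uniformly in `x`. -/
theorem abs_pruferField_sub_le (V : ℝ → ℝ) (E x y z : ℝ) :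
    |pruferField V E x y - pruferField V E x z| ≤ 2 * |E - V x - 1| * |y - z| := by
  have h1 : pruferField V E x y - pruferField V E x z
      = (E - V x - 1) * (Real.sin y + Real.sin z) * (Real.sin y - Real.sin z) := by
    simp only [pruferField, Real.cos_sq']
    ring
  rw [h1, abs_mul, abs_mul, mul_comm 2]
  have h2 : |Real.sin y + Real.sin z| ≤ 2 := by
    have := abs_add_le (Real.sin y) (Real.sin z)
    have := Real.abs_sin_le_one y
    have := Real.abs_sin_le_one z
    linarith
  have h3 := Real.abs_sin_sub_sin_le y z
  gcongr

theorem exists_bound_on_Icc {V : ℝ → ℝ} (hV : Continuous V) (E a b : ℝ) :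
    ∃ M : NNReal, ∀ x ∈ Set.Icc a b, |E - V x - 1| ≤ M := by
  obtain ⟨M, hM⟩ := isCompact_Icc.exists_bound_of_continuousOn (s := Set.Icc a b)
    (f := fun x => E - V x - 1) (by fun_prop)
  exact ⟨M.toNNReal, fun x hx => (hM x hx).trans (Real.le_coe_toNNReal M)⟩

/-- Comparison of a sub- and a supersolution of the Prüfer equation. -/
theorem pruferField_comparison {V : ℝ → ℝ} (hV : Continuous V) {E a b : ℝ} (hab : a ≤ b)
    {α β α' β' : ℝ → ℝ} (hα : ∀ x, HasDerivAt α (α' x) x) (hβ : ∀ x, HasDerivAt β (β' x) x)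
    (h1 : ∀ x ∈ Set.Icc a b, α' x ≤ pruferField V E x (α x))
    (h2 : ∀ x ∈ Set.Icc a b, pruferField V E x (β x) ≤ β' x) (h : α a ≤ β a) : α b ≤ β b := by
  obtain ⟨M, hM⟩ := exists_bound_on_Icc hV E a b
  have := nonpos_of_deriv_le_mul (g := fun x => α x - β x) (K := 2 * M) hab
    (fun x => (hα x).sub (hβ x)) ?_ (by simpa using h)
  · simpa using this
  · intro x hx hpos
    have h3 := abs_pruferField_sub_le V E x (α x) (β x)
    rw [abs_of_pos hpos] at h3
    have h4 := (abs_le.1 h3).2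
    have h5 : 2 * |E - V x - 1| * (α x - β x) ≤ 2 * M * (α x - β x) := by
      have := hM x hx
      gcongr
    linarith [h1 x hx, h2 x hx]

namespace IsPruferAngle

variable {V : ℝ → ℝ} {E : ℝ} {θ : ℝ → ℝ}

theorem continuous (h : IsPruferAngle V E θ) : Continuous θ :=
  continuous_iff_continuousAt.2 fun x => (h x).continuousAt

/-- Reflection of the line transfers every statement about right half-lines to left half-lines. -/
theorem reflect (h : IsPruferAngle V E θ) :
    IsPruferAngle (fun x => V (-x)) E (fun x => -θ (-x)) := by
  intro x
  have := ((h (-x)).comp x (hasDerivAt_neg x)).neg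
  convert! this using 1
  simp [pruferField]

theorem add_int_mul_pi (h : IsPruferAngle V E θ) (m : ℤ) :
    IsPruferAngle V E (fun x => θ x + m * Real.pi) := by
  intro x
  have := (h x).add_const (m * Real.pi)
  convert! this using 1
  have e : ((-1 : ℝ) ^ m) ^ 2 = 1 := by
    rw [← zpow_natCast, ← zpow_mul, mul_comm, zpow_mul]
    simp
  simp only [pruferField, Real.cos_add_int_mul_pi, Real.sin_add_int_mul_pi, mul_pow, e, one_mul]

theorem translate {c : ℝ} (h : IsPruferAngle (fun x => V (x + c)) E θ) :
    IsPruferAngle V E (fun x => θ (x - c)) := by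
  intro x
  have := (h (x - c)).comp x ((hasDerivAt_id x).sub_const c)
  convert! this using 1
  simp [pruferField]

/-- Prüfer angles are monotone in the energy and in the initial value. -/
theorem le_of_le (hV : Continuous V) (h : IsPruferAngle V E θ) {E' : ℝ} {φ : ℝ → ℝ}
    (h' : IsPruferAngle V E' φ) (hE : E ≤ E') {a b : ℝ} (hab : a ≤ b) (ha : θ a ≤ φ a) :
    θ b ≤ φ b := by
  refine pruferField_comparison hV (E := E') hab h h' ?_ (fun x _ => le_rfl) ha
  intro x _
  simp only [pruferField]
  gcongr

theorem unique (hV : Continuous V) (h : IsPruferAngle V E θ) {φ : ℝ → ℝ}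
    (h' : IsPruferAngle V E φ) {a : ℝ} (ha : θ a = φ a) : θ = φ := by
  have key : ∀ {V θ φ} {a : ℝ}, Continuous V → IsPruferAngle V E θ → IsPruferAngle V E φ →
      θ a = φ a → ∀ b, a ≤ b → θ b = φ b := by
    intro V θ φ a hV h h' ha b hab
    exact le_antisymm (h.le_of_le hV h' le_rfl hab ha.le) (h'.le_of_le hV h le_rfl hab ha.ge)
  funext b
  rcases le_total a b with hab | hab
  · exact key hV h h' ha b hab
  · have := key (a := -a) (hV.comp continuous_neg) h.reflect h'.reflect (by simp [ha]) (-b)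
      (by linarith)
    simpa using this

/-- Multiples of `π` can only be crossed upwards. -/
theorem int_mul_pi_le (hV : Continuous V) (h : IsPruferAngle V E θ) (m : ℤ) {a b : ℝ}
    (hab : a ≤ b) (ha : m * Real.pi ≤ θ a) : m * Real.pi ≤ θ b := by
  refine pruferField_comparison hV (E := E) hab (fun x => hasDerivAt_const x (m * Real.pi)) h ?_
    (fun x _ => le_rfl) ha
  intro x _
  simp [pruferField, Real.sin_int_mul_pi, sq_nonneg]

theorem le_int_mul_pi (hV : Continuous V) (h : IsPruferAngle V E θ) (m : ℤ) {a b : ℝ}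
    (hab : a ≤ b) (hb : θ b ≤ m * Real.pi) : θ a ≤ m * Real.pi := by
  have := h.reflect.int_mul_pi_le (hV.comp continuous_neg) (-m) (a := -b) (b := -a) (by linarith)
    (by push_cast; simp only [neg_neg]; linarith)
  push_cast at this
  simp only [neg_neg] at this
  linarith

/-- Touching `mπ` at `b` would be a local minimum, yet the field equals `1` at multiples of `π`. -/
theorem int_mul_pi_lt (hV : Continuous V) (h : IsPruferAngle V E θ) (m : ℤ) {a b : ℝ}
    (hab : a < b) (ha : m * Real.pi ≤ θ a) : m * Real.pi < θ b := by
  refine lt_of_le_of_ne (h.int_mul_pi_le hV m hab.le ha) fun hb => ?_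
  have hmin : IsLocalMin θ b := by
    filter_upwards [lt_mem_nhds hab] with x hx
    rw [← hb]
    exact h.int_mul_pi_le hV m hx.le ha
  have h0 := hmin.hasDerivAt_eq_zero (h b)
  simp [pruferField, ← hb, Real.cos_sq'] at h0

/-- In the classically forbidden region, odd multiples of `π / 2` can only be crossed downwards. -/
theorem le_half_pi (hV : Continuous V) (h : IsPruferAngle V E θ) (m : ℤ) {a b : ℝ}
    (hab : a ≤ b) (hVE : ∀ x ∈ Set.Icc a b, E ≤ V x) (ha : θ a ≤ m * Real.pi + Real.pi / 2) :
    θ b ≤ m * Real.pi + Real.pi / 2 := by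
  refine pruferField_comparison hV (E := E) hab h
    (fun x => hasDerivAt_const x (m * Real.pi + Real.pi / 2)) (fun x _ => le_rfl) ?_ ha
  intro x hx
  have : Real.cos (m * Real.pi + Real.pi / 2) = 0 := by
    rw [Real.cos_add_pi_div_two, Real.sin_int_mul_pi, neg_zero]
  simp only [pruferField, this]
  have := hVE x hx
  nlinarith [sq_nonneg (Real.sin (m * Real.pi + Real.pi / 2))]

end IsPruferAngle

/-! ### Global existence and continuous dependence of Prüfer angles -/

theorem exists_prufer_angle_on_Icc {V : ℝ → ℝ} (hV : Continuous V) (E y : ℝ) {T : ℝ} (hT : 0 ≤ T) :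
    ∃ θ : ℝ → ℝ, θ 0 = y ∧
      ∀ x ∈ Set.Icc (-T) T, HasDerivWithinAt θ (pruferField V E x (θ x)) (Set.Icc (-T) T) x := by
  obtain ⟨M, hM⟩ := exists_bound_on_Icc hV E (-T) T
  -- The field is bounded by `1 + M`, so the angle moves by at most `(1 + M) T` and the solution
  -- exists on the whole interval.
  have hpl : IsPicardLindelof (pruferField V E) (⟨0, by simpa using hT, hT⟩ : Set.Icc (-T) T) y
      ((1 + M) * T.toNNReal) 0 (1 + M) (2 * M) := by
    constructor
    · intro t ht
      refine LipschitzOnWith.of_dist_le_mul fun u _ v _ => ?_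
      rw [Real.dist_eq, Real.dist_eq]
      refine (abs_pruferField_sub_le V E t u v).trans ?_
      have := hM t ht
      push_cast
      gcongr
    · intro u _
      unfold pruferField
      fun_prop
    · intro t ht u _
      have e : pruferField V E t u = 1 + (E - V t - 1) * Real.sin u ^ 2 := by
        simp only [pruferField, Real.cos_sq']; ring
      push_cast
      rw [e, Real.norm_eq_abs]
      refine (abs_add_le _ _).trans ?_
      rw [abs_one, abs_mul, abs_of_nonneg (sq_nonneg (Real.sin u))]
      have h1 := hM t ht
      have h2 := Real.sin_sq_le_one u
      nlinarith [abs_nonneg (E - V t - 1), sq_nonneg (Real.sin u)]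
    · simp [hT]
  exact hpl.exists_eq_forall_mem_Icc_hasDerivWithinAt₀

theorem exists_isPruferAngle_zero {V : ℝ → ℝ} (hV : Continuous V) (E y : ℝ) :
    ∃ θ : ℝ → ℝ, θ 0 = y ∧ IsPruferAngle V E θ := by
  choose α hα0 hα using fun n : ℕ =>
    exists_prufer_angle_on_Icc hV E y (T := (n : ℝ) + 1) (by positivity)
  have hd : ∀ (n : ℕ) (x : ℝ), |x| < n + 1 → HasDerivAt (α n) (pruferField V E x (α n x)) x := by
    intro n x hx
    have hx' := abs_lt.1 hx
    exact (hα n x ⟨hx'.1.le, hx'.2.le⟩).hasDerivAt (Icc_mem_nhds hx'.1 hx'.2)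
  have heq : ∀ (m n : ℕ) (x : ℝ), m ≤ n → |x| < m + 1 → α m x = α n x := by
    intro m n x hmn hx
    obtain ⟨M, hM⟩ := exists_bound_on_Icc hV E (-((m : ℝ) + 1)) (m + 1)
    have hmn' : (m : ℝ) ≤ n := by exact_mod_cast hmn
    refine ODE_solution_unique_of_mem_Ioo (v := pruferField V E) (K := (2 * M))
      (s := fun _ => Set.univ) (a := -((m : ℝ) + 1)) (b := m + 1) (t₀ := 0) ?_ ?_ ?_ ?_ ?_ ?_
    · intro t ht
      refine LipschitzOnWith.of_dist_le_mul fun u _ v _ => ?_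
      rw [Real.dist_eq, Real.dist_eq]
      refine (abs_pruferField_sub_le V E t u v).trans ?_
      have := hM t ⟨ht.1.le, ht.2.le⟩
      push_cast
      gcongr
    · have : (0 : ℝ) < m + 1 := by positivity
      exact ⟨by linarith, this⟩
    · exact fun t ht => ⟨hd m t (abs_lt.2 ht), trivial⟩
    · exact fun t ht => ⟨hd n t (lt_of_lt_of_le (abs_lt.2 ht) (by linarith)), trivial⟩
    · rw [hα0, hα0]
    · exact abs_lt.1 hx
  have hfl : ∀ x : ℝ, |x| < (⌊|x|⌋₊ : ℝ) + 1 := fun x => Nat.lt_floor_add_one _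
  -- Local solutions agree on overlaps by `heq`, so near `x` the glued function is the single
  -- solution indexed by `⌊|x|⌋₊`.
  refine ⟨fun x => α ⌊|x|⌋₊ x, by simp [hα0], fun x => ?_⟩
  refine (hd ⌊|x|⌋₊ x (hfl x)).congr_of_eventuallyEq ?_
  filter_upwards [(continuous_abs.tendsto x).eventually (gt_mem_nhds (hfl x))] with z hz
  refine heq _ _ z ?_ (hfl z)
  have : ⌊|z|⌋₊ < ⌊|x|⌋₊ + 1 := by
    rw [Nat.floor_lt (abs_nonneg _)]
    exact_mod_cast hz
  omega

theorem exists_isPruferAngle {V : ℝ → ℝ} (hV : Continuous V) (E c y : ℝ) :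
    ∃ θ : ℝ → ℝ, θ c = y ∧ IsPruferAngle V E θ := by
  obtain ⟨θ, h0, h⟩ := exists_isPruferAngle_zero (V := fun x => V (x + c)) (by fun_prop) E y
  exact ⟨_, by simpa using h0, h.translate⟩

/-- An angle at energy `E'` solves the equation at energy `E` up to the error `(E' - E) sin²`, so
Grönwall applies. -/
theorem IsPruferAngle.dist_le {V : ℝ → ℝ} (hV : Continuous V) (E a b : ℝ) :
    ∃ K : NNReal, ∀ {E' : ℝ} {θ φ : ℝ → ℝ}, IsPruferAngle V E θ → IsPruferAngle V E' φ → a ≤ b →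
      dist (φ b) (θ b) ≤ gronwallBound (dist (φ a) (θ a)) K |E' - E| (b - a) := by
  obtain ⟨M, hM⟩ := exists_bound_on_Icc hV E a b
  refine ⟨(2 * M), fun {E' θ φ} hθ hφ hab => ?_⟩
  have := dist_le_of_approx_trajectories_ODE_of_mem (v := pruferField V E)
      (K := (2 * M)) (s := fun _ => Set.univ) (a := a) (b := b)
      (f := φ) (g := θ) (δ := dist (φ a) (θ a))
      (f' := fun t => pruferField V E' t (φ t)) (g' := fun t => pruferField V E t (θ t))
      (εf := |E' - E|) (εg := 0) ?_
      hφ.continuous.continuousOn (fun t _ => (hφ t).hasDerivWithinAt) ?_ (fun _ _ => trivial)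
      hθ.continuous.continuousOn (fun t _ => (hθ t).hasDerivWithinAt) (by simp)
      (fun _ _ => trivial) le_rfl b ⟨hab, le_rfl⟩
  · simpa using this
  · intro t ht
    refine LipschitzOnWith.of_dist_le_mul fun u _ v _ => ?_
    rw [Real.dist_eq, Real.dist_eq]
    refine (abs_pruferField_sub_le V E t u v).trans ?_
    have := hM t ⟨ht.1, ht.2.le⟩
    push_cast
    gcongr
  · intro t _
    have e : pruferField V E' t (φ t) - pruferField V E t (φ t)
        = (E' - E) * Real.sin (φ t) ^ 2 := by
      simp only [pruferField]; ring
    rw [Real.dist_eq, e, abs_mul, abs_of_nonneg (sq_nonneg (Real.sin _))]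
    nlinarith [Real.sin_sq_le_one (φ t), abs_nonneg (E' - E)]

theorem tendsto_gronwallBound {ι : Type*} {l : Filter ι} {δ ε : ι → ℝ} (hδ : Tendsto δ l (𝓝 0))
    (hε : Tendsto ε l (𝓝 0)) (K x : ℝ) :
    Tendsto (fun i => gronwallBound (δ i) K (ε i) x) l (𝓝 0) := by
  by_cases hK : K = 0
  · subst hK
    simp only [gronwallBound_K0]
    simpa using hδ.add (hε.mul_const x)
  · simp only [gronwallBound_of_K_ne_0 hK]
    simpa using (hδ.mul_const (Real.exp (K * x))).add
      ((hε.div_const K).mul_const (Real.exp (K * x) - 1))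

/-- Continuous dependence of Prüfer angles on the energy and on the initial value. -/
theorem IsPruferAngle.tendsto {V : ℝ → ℝ} (hV : Continuous V) {ι : Type*} {l : Filter ι}
    {E : ℝ} {θ : ℝ → ℝ} {Es : ι → ℝ} {θs : ι → ℝ → ℝ} (hθ : IsPruferAngle V E θ)
    (hθs : ∀ i, IsPruferAngle V (Es i) (θs i)) (hE : Tendsto Es l (𝓝 E)) {a : ℝ}
    (ha : Tendsto (fun i => θs i a) l (𝓝 (θ a))) (b : ℝ) :
    Tendsto (fun i => θs i b) l (𝓝 (θ b)) := by
  have key : ∀ {V : ℝ → ℝ} {θ : ℝ → ℝ} {θs : ι → ℝ → ℝ} {a b : ℝ}, Continuous V →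
      IsPruferAngle V E θ → (∀ i, IsPruferAngle V (Es i) (θs i)) → a ≤ b →
      Tendsto (fun i => θs i a) l (𝓝 (θ a)) → Tendsto (fun i => θs i b) l (𝓝 (θ b)) := by
    intro V θ θs a b hV hθ hθs hab ha
    obtain ⟨K, hK⟩ := IsPruferAngle.dist_le hV E a b
    rw [tendsto_iff_dist_tendsto_zero] at ha ⊢
    have hE' : Tendsto (fun i => |Es i - E|) l (𝓝 0) := by
      simpa [Real.dist_eq] using tendsto_iff_dist_tendsto_zero.1 hE
    exact squeeze_zero (fun _ => dist_nonneg) (fun i => hK hθ (hθs i) hab)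
      (tendsto_gronwallBound ha hE' K (b - a))
  rcases le_total a b with hab | hab
  · exact key hV hθ hθs hab ha
  · have := key (a := -a) (b := -b) (hV.comp continuous_neg) hθ.reflect (fun i => (hθs i).reflect)
      (by linarith) (by simpa using ha.neg)
    simpa using this.neg

/-! ### Classical solutions and their polar form -/

/-- `u` solves `-u'' + V u = E u`, with derivative `v`. -/
structure IsSolution (V : ℝ → ℝ) (E : ℝ) (u v : ℝ → ℝ) : Prop where
  deriv_fst : ∀ x, HasDerivAt u (v x) x
  deriv_snd : ∀ x, HasDerivAt v ((V x - E) * u x) x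

theorem IsSingleWell.reflect {V : ℝ → ℝ} (hV : IsSingleWell V) :
    IsSingleWell fun x => V (-x) where
  continuous := hV.continuous.comp continuous_neg
  nonneg x := hV.nonneg _
  zero := by simpa using hV.zero
  strictMonoOn x hx y hy hxy :=
    hV.strictAntiOn (by simpa using hy) (by simpa using hx) (by simpa using hxy)
  strictAntiOn x hx y hy hxy :=
    hV.strictMonoOn (by simpa using hy) (by simpa using hx) (by simpa using hxy)
  tendsto_atTop := hV.tendsto_atBot.comp tendsto_neg_atTop_atBot
  tendsto_atBot := hV.tendsto_atTop.comp tendsto_neg_atBot_atTop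

namespace IsSolution

variable {V : ℝ → ℝ} {E : ℝ} {u v : ℝ → ℝ}

theorem continuous_fst (h : IsSolution V E u v) : Continuous u :=
  continuous_iff_continuousAt.2 fun x => (h.deriv_fst x).continuousAt

theorem continuous_snd (h : IsSolution V E u v) : Continuous v :=
  continuous_iff_continuousAt.2 fun x => (h.deriv_snd x).continuousAt

theorem linear_comb (h : IsSolution V E u v) {u' v' : ℝ → ℝ} (h' : IsSolution V E u' v')
    (a b : ℝ) : IsSolution V E (fun x => a * u x + b * u' x) (fun x => a * v x + b * v' x) := by
  refine ⟨fun x => ((h.deriv_fst x).const_mul a).add ((h'.deriv_fst x).const_mul b), fun x => ?_⟩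
  convert! ((h.deriv_snd x).const_mul a).add ((h'.deriv_snd x).const_mul b) using 1
  ring

theorem reflect (h : IsSolution V E u v) :
    IsSolution (fun x => V (-x)) E (fun x => u (-x)) (fun x => -v (-x)) := by
  refine ⟨fun x => ?_, fun x => ?_⟩
  · convert! (h.deriv_fst (-x)).comp x (hasDerivAt_neg x) using 1
    ring
  · convert! ((h.deriv_snd (-x)).comp x (hasDerivAt_neg x)).neg using 1
    ring

theorem hasDerivAt_wronskian (h : IsSolution V E u v) {E' : ℝ} {u' v' : ℝ → ℝ}
    (h' : IsSolution V E' u' v') (x : ℝ) :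
    HasDerivAt (fun x => u x * v' x - v x * u' x) ((E - E') * (u x * u' x)) x := by
  convert! ((h.deriv_fst x).mul (h'.deriv_snd x)).sub ((h.deriv_snd x).mul (h'.deriv_fst x)) using 1
  ring

theorem wronskian_eq (h : IsSolution V E u v) {u' v' : ℝ → ℝ} (h' : IsSolution V E u' v')
    (x : ℝ) : u x * v' x - v x * u' x = u 0 * v' 0 - v 0 * u' 0 :=
  is_const_of_deriv_eq_zero (f := fun x => u x * v' x - v x * u' x)
    (fun x => (h.hasDerivAt_wronskian h' x).differentiableAt)
    (fun x => by rw [(h.hasDerivAt_wronskian h' x).deriv]; ring) x 0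

theorem hasDerivAt_mul (h : IsSolution V E u v) (x : ℝ) :
    HasDerivAt (fun x => u x * v x) (v x ^ 2 + (V x - E) * u x ^ 2) x := by
  convert! (h.deriv_fst x).mul (h.deriv_snd x) using 1
  ring

theorem hasDerivAt_sq (h : IsSolution V E u v) (x : ℝ) :
    HasDerivAt (fun x => u x ^ 2) (2 * (u x * v x)) x := by
  convert! (h.deriv_fst x).pow 2 using 1
  push_cast
  ring

end IsSolution

theorem IsPruferAngle.exists_solution {V : ℝ → ℝ} (hV : Continuous V) {E : ℝ} {θ : ℝ → ℝ}
    (hθ : IsPruferAngle V E θ) :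
    ∃ r : ℝ → ℝ, (∀ x, 0 < r x) ∧ r 0 = 1 ∧
      IsSolution V E (fun x => r x * Real.sin (θ x)) (fun x => r x * Real.cos (θ x)) := by
  -- The polar form forces `r' / r = f`.
  set f : ℝ → ℝ := fun x => (1 - (E - V x)) * (Real.sin (θ x) * Real.cos (θ x)) with hf
  have hfc : Continuous f := by
    have := hθ.continuous
    fun_prop
  have hd : ∀ x, HasDerivAt (fun x => Real.exp (∫ t in (0 : ℝ)..x, f t))
      (Real.exp (∫ t in (0 : ℝ)..x, f t) * f x) x := fun x =>
    (hfc.integral_hasStrictDerivAt 0 x).hasDerivAt.exp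
  refine ⟨fun x => Real.exp (∫ t in (0 : ℝ)..x, f t), fun x => Real.exp_pos _, by simp, ?_, ?_⟩
  · intro x
    convert! (hd x).mul (hθ x).sin using 1
    simp only [hf, pruferField]
    linear_combination (-(Real.exp (∫ t in (0 : ℝ)..x, f t) * Real.cos (θ x)))
      * Real.sin_sq_add_cos_sq (θ x)
  · intro x
    convert! (hd x).mul (hθ x).cos using 1
    simp only [hf, pruferField]
    linear_combination (Real.exp (∫ t in (0 : ℝ)..x, f t) * Real.sin (θ x) * (E - V x))
      * Real.sin_sq_add_cos_sq (θ x)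

/-- A fundamental system with Wronskian one. -/
theorem exists_fundamental_system {V : ℝ → ℝ} (hV : Continuous V) (E : ℝ) :
    ∃ u₁ v₁ u₂ v₂ : ℝ → ℝ, IsSolution V E u₁ v₁ ∧ IsSolution V E u₂ v₂ ∧
      ∀ x, u₁ x * v₂ x - v₁ x * u₂ x = 1 := by
  obtain ⟨θ, hθ0, hθ⟩ := exists_isPruferAngle hV E 0 0
  obtain ⟨φ, hφ0, hφ⟩ := exists_isPruferAngle hV E 0 (Real.pi / 2)
  obtain ⟨r, -, hr0, hr⟩ := hθ.exists_solution hV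
  obtain ⟨s, -, hs0, hs⟩ := hφ.exists_solution hV
  refine ⟨_, _, _, _, hs, hr, fun x => ?_⟩
  rw [hs.wronskian_eq hr]
  simp [hθ0, hφ0, hr0, hs0]

/-- Both Wronskians against a fundamental system vanish, and Cramer's rule recovers `u` and `v` from
them. -/
theorem IsSolution.eq_zero {V : ℝ → ℝ} (hV : Continuous V) {E : ℝ} {u v : ℝ → ℝ}
    (h : IsSolution V E u v) (hu : u 0 = 0) (hv : v 0 = 0) (x : ℝ) : u x = 0 ∧ v x = 0 := by
  obtain ⟨u₁, v₁, u₂, v₂, h₁, h₂, hW⟩ := exists_fundamental_system hV E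
  have e1 := h.wronskian_eq h₁ x
  have e2 := h.wronskian_eq h₂ x
  simp only [hu, hv, zero_mul, sub_zero] at e1 e2
  constructor
  · linear_combination (-(u x)) * hW x + u₁ x * e2 - u₂ x * e1
  · linear_combination (-(v x)) * hW x + v₁ x * e2 - v₂ x * e1

/-- Every nontrivial solution has a Prüfer angle. -/
theorem IsSolution.exists_isPruferAngle {V : ℝ → ℝ} (hV : Continuous V) {E : ℝ} {u v : ℝ → ℝ}
    (h : IsSolution V E u v) {x₀ : ℝ} (h0 : u x₀ ≠ 0) :
    ∃ θ r : ℝ → ℝ, IsPruferAngle V E θ ∧ (∀ x, 0 < r x) ∧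
      (∀ x, u x = r x * Real.sin (θ x)) ∧ ∀ x, v x = r x * Real.cos (θ x) := by
  -- The argument of `u'(0) + i u(0)` is the initial angle and its modulus the initial radius; the
  -- resulting solution has the same data at `0`.
  set z : ℂ := ⟨v 0, u 0⟩ with hz
  have hz0 : z ≠ 0 := by
    intro hz0
    have h1 := congrArg Complex.re hz0
    have h2 := congrArg Complex.im hz0
    exact h0 (h.eq_zero hV h2 h1 x₀).1
  obtain ⟨θ, hθ0, hθ⟩ := _root_.exists_isPruferAngle hV E 0 z.arg
  obtain ⟨r, hr, hr0, hs⟩ := hθ.exists_solution hV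
  have hd := h.linear_comb hs 1 (-‖z‖)
  have hc := Complex.norm_mul_cos_arg z
  have hs' := Complex.norm_mul_sin_arg z
  have key := hd.eq_zero hV
    (by simp only [hθ0, hr0]; rw [one_mul, one_mul, neg_mul, hs']; simp [hz])
    (by simp only [hθ0, hr0]; rw [one_mul, one_mul, neg_mul, hc]; simp [hz])
  refine ⟨θ, fun x => ‖z‖ * r x, hθ, fun x => mul_pos (norm_pos_iff.2 hz0) (hr x), fun x => ?_,
    fun x => ?_⟩
  · linear_combination (key x).1
  · linear_combination (key x).2

/-! ### Square integrability and the sign of `u u'` -/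

/-- A positive constant is not integrable on a half-line. Decay is extracted from integrability only
in this form. -/
theorem nonpos_of_le_of_integrableOn {g : ℝ → ℝ} {c δ : ℝ} (hg : IntegrableOn g (Set.Ioi c))
    (h : ∀ x, c < x → δ ≤ g x) : δ ≤ 0 := by
  by_contra! hδ
  have h1 : IntegrableOn (fun _ : ℝ => δ) (Set.Ioi c) := by
    refine Integrable.mono' hg aestronglyMeasurable_const ?_
    filter_upwards [ae_restrict_mem measurableSet_Ioi] with x hx
    rw [Real.norm_of_nonneg hδ.le]
    exact h x hx
  rw [integrableOn_const_iff] at h1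
  simp [hδ.ne'] at h1

namespace IsSolution

variable {V : ℝ → ℝ} {E : ℝ} {u v : ℝ → ℝ}

theorem monotoneOn_mul (h : IsSolution V E u v) {c : ℝ} (hVE : ∀ x, c ≤ x → E ≤ V x) :
    MonotoneOn (fun x => u x * v x) (Set.Ici c) := by
  refine monotoneOn_of_deriv_nonneg (convex_Ici c)
    (fun x _ => (h.hasDerivAt_mul x).continuousAt.continuousWithinAt)
    (fun x _ => (h.hasDerivAt_mul x).differentiableAt.differentiableWithinAt) fun x hx => ?_
  rw [interior_Ici] at hx
  rw [(h.hasDerivAt_mul x).deriv]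
  have := hVE x (le_of_lt hx)
  have : 0 ≤ (V x - E) * u x ^ 2 := _root_.mul_nonneg (by linarith) (sq_nonneg _)
  positivity

/-- A square-integrable solution does not grow in the classically forbidden region. -/
theorem mul_nonpos_of_integrableOn (h : IsSolution V E u v) {c : ℝ}
    (hVE : ∀ x, c ≤ x → E ≤ V x) (hu : IntegrableOn (fun x => u x ^ 2) (Set.Ioi c)) {x : ℝ}
    (hx : c ≤ x) : u x * v x ≤ 0 := by
  -- As `(u u')' = u'² + (V - E) u² ≥ 0`, a positive value of `u u'` persists to the right; then
  -- `u²` increases and cannot be integrable.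
  by_contra! hpos
  have hmono := h.monotoneOn_mul (c := x) fun y hy => hVE y (hx.trans hy)
  have hsq : MonotoneOn (fun x => u x ^ 2) (Set.Ici x) := by
    refine monotoneOn_of_deriv_nonneg (convex_Ici x)
      (fun x _ => (h.hasDerivAt_sq x).continuousAt.continuousWithinAt)
      (fun x _ => (h.hasDerivAt_sq x).differentiableAt.differentiableWithinAt) fun y hy => ?_
    rw [interior_Ici] at hy
    rw [(h.hasDerivAt_sq y).deriv]
    have : u x * v x ≤ u y * v y :=
      hmono Set.self_mem_Ici (Set.mem_Ici.2 (Set.mem_Ioi.1 hy).le) (Set.mem_Ioi.1 hy).le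
    linarith
  have h1 := nonpos_of_le_of_integrableOn (hu.mono_set (Set.Ioi_subset_Ioi hx))
    (fun y hy => hsq Set.self_mem_Ici (le_of_lt hy) (le_of_lt hy))
  have h2 : u x = 0 := by nlinarith
  simp [h2] at hpos

/-- The derivative of `K u² - u'²` is `2 u u' (K - (V - E))`, a product of nonpositive factors, so
this function is nondecreasing. It lies below the integrable `K u²`, hence is nowhere positive. This
bounds the logarithmic derivative at the edge of the well. -/
theorem mul_sq_le_sq (h : IsSolution V E u v) {c K : ℝ} (hK : 0 ≤ K)
    (hVE : ∀ x, c ≤ x → E + K ≤ V x) (hu : IntegrableOn (fun x => u x ^ 2) (Set.Ioi c)) :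
    K * u c ^ 2 ≤ v c ^ 2 := by
  have hneg : ∀ x, c ≤ x → u x * v x ≤ 0 := fun x hx =>
    h.mul_nonpos_of_integrableOn (fun y hy => by linarith [hVE y hy]) hu hx
  have hd : ∀ x, HasDerivAt (fun x => K * u x ^ 2 - v x ^ 2)
      (2 * (u x * v x) * (K - (V x - E))) x := by
    intro x
    convert! ((h.hasDerivAt_sq x).const_mul K).sub ((h.deriv_snd x).pow 2) using 1
    push_cast
    ring
  have hmono : MonotoneOn (fun x => K * u x ^ 2 - v x ^ 2) (Set.Ici c) := by
    refine monotoneOn_of_deriv_nonneg (convex_Ici c)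
      (fun x _ => (hd x).continuousAt.continuousWithinAt)
      (fun x _ => (hd x).differentiableAt.differentiableWithinAt) fun x hx => ?_
    rw [interior_Ici] at hx
    rw [(hd x).deriv]
    have h1 := hneg x (le_of_lt hx)
    have h2 := hVE x (le_of_lt hx)
    nlinarith
  have := nonpos_of_le_of_integrableOn (δ := K * u c ^ 2 - v c ^ 2) (hu.const_mul K) fun x hx => by
    have h1 : K * u c ^ 2 - v c ^ 2 ≤ K * u x ^ 2 - v x ^ 2 :=
      hmono Set.self_mem_Ici (le_of_lt hx) (le_of_lt hx)
    nlinarith [sq_nonneg (v x)]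
  linarith

/-- Here `(u u')' ≥ u² + u'²`; integrating up to `T` bounds the integral by `-u(c) u'(c)`, because
`u(T) u'(T) ≤ 0`. -/
theorem integrableOn_of_mul_nonpos (hV : Continuous V) (h : IsSolution V E u v)
    {c : ℝ}
    (hVE : ∀ x, c ≤ x → E + 1 ≤ V x) (hneg : ∀ x, c ≤ x → u x * v x ≤ 0) :
    IntegrableOn (fun x => u x ^ 2 + v x ^ 2) (Set.Ioi c) := by
  have hcu := h.continuous_fst
  have hcv := h.continuous_snd
  refine integrableOn_Ioi_of_intervalIntegral_norm_bounded (l := atTop) (b := id)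
    (-(u c * v c)) c (fun i => ?_) tendsto_id ?_
  · exact (Continuous.integrableOn_Icc (by fun_prop)).mono_set Set.Ioc_subset_Icc_self
  · filter_upwards [eventually_ge_atTop c] with T hT
    have h1 : ∫ x in c..T, (v x ^ 2 + (V x - E) * u x ^ 2) = u T * v T - u c * v c :=
      intervalIntegral.integral_eq_sub_of_hasDerivAt (fun x _ => h.hasDerivAt_mul x)
        (Continuous.intervalIntegrable (by fun_prop) _ _)
    have h2 : ∫ x in c..T, ‖u x ^ 2 + v x ^ 2‖ ≤ ∫ x in c..T, (v x ^ 2 + (V x - E) * u x ^ 2) := by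
      refine intervalIntegral.integral_mono_on hT
        (Continuous.intervalIntegrable (by fun_prop) _ _)
        (Continuous.intervalIntegrable (by fun_prop) _ _) fun x hx => ?_
      rw [Real.norm_of_nonneg (by positivity)]
      have := hVE x hx.1
      nlinarith [sq_nonneg (u x)]
    have h3 := hneg T hT
    simp only [id]
    linarith

theorem integrable_of_tails (hV : IsSingleWell V) (h : IsSolution V E u v)
    (htop : ∀ᶠ x in atTop, u x * v x ≤ 0) (hbot : ∀ᶠ x in atBot, 0 ≤ u x * v x) :
    Integrable fun x => u x ^ 2 + v x ^ 2 := by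
  have half : ∀ {V u v : ℝ → ℝ}, IsSingleWell V → IsSolution V E u v →
      (∀ᶠ x in atTop, u x * v x ≤ 0) →
      ∃ c, IntegrableOn (fun x => u x ^ 2 + v x ^ 2) (Set.Ioi c) := by
    intro V u v hV h ht
    obtain ⟨c, hc⟩ := eventually_atTop.1
      (ht.and (hV.tendsto_atTop.eventually (eventually_ge_atTop (E + 1))))
    exact ⟨c, h.integrableOn_of_mul_nonpos hV.continuous (fun x hx => (hc x hx).2)
      fun x hx => (hc x hx).1⟩
  obtain ⟨c, hc⟩ := half hV h htop
  obtain ⟨d, hd⟩ := half hV.reflect h.reflect (by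
    filter_upwards [tendsto_neg_atTop_atBot.eventually hbot] with x hx
    linarith)
  have hd' : IntegrableOn (fun x => u x ^ 2 + v x ^ 2) (Set.Iio (-d)) := by
    have := hd.comp_neg
    simpa using this
  have hcont : Continuous fun x => u x ^ 2 + v x ^ 2 := by
    have := h.continuous_fst
    have := h.continuous_snd
    fun_prop
  have hm : IntegrableOn (fun x => u x ^ 2 + v x ^ 2) (Set.Icc (-d) c) :=
    hcont.integrableOn_Icc
  rw [← integrableOn_univ]
  refine ((hd'.union hm).union hc).mono_set fun x _ => ?_
  rcases lt_or_ge x (-d) with h1 | h1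
  · exact Or.inl (Or.inl h1)
  · rcases le_or_gt x c with h2 | h2
    · exact Or.inl (Or.inr ⟨h1, h2⟩)
    · exact Or.inr h2

/-- Sign of `u u'` to the right of the well. -/
theorem mul_nonpos (h : IsSolution V E u v) {c : ℝ} (hVE : ∀ x, c ≤ x → E ≤ V x)
    (hu : Integrable fun x => u x ^ 2) {x : ℝ} (hx : c ≤ x) : u x * v x ≤ 0 :=
  h.mul_nonpos_of_integrableOn hVE hu.integrableOn hx

/-- Sign of `u u'` to the left of the well. -/
theorem mul_nonneg (h : IsSolution V E u v) {c : ℝ} (hVE : ∀ x, x ≤ c → E ≤ V x)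
    (hu : Integrable fun x => u x ^ 2) {x : ℝ} (hx : x ≤ c) : 0 ≤ u x * v x := by
  have := h.reflect.mul_nonpos (c := -c) (fun y hy => hVE _ (by linarith)) hu.comp_neg
    (x := -x) (by linarith)
  simp only [neg_neg] at this
  linarith

theorem integrable_snd (hV : IsSingleWell V) (h : IsSolution V E u v)
    (hu : Integrable fun x => u x ^ 2) : Integrable fun x => v x ^ 2 := by
  have h1 := h.integrable_of_tails hV ?_ ?_
  · refine (h1.sub hu).congr (Eventually.of_forall fun x => ?_)
    simp
  · obtain ⟨c, hc⟩ := eventually_atTop.1 (hV.tendsto_atTop.eventually (eventually_ge_atTop E))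
    filter_upwards [eventually_ge_atTop c] with x hx using h.mul_nonpos hc hu hx
  · obtain ⟨c, hc⟩ := eventually_atBot.1 (hV.tendsto_atBot.eventually (eventually_ge_atTop E))
    filter_upwards [eventually_le_atBot c] with x hx using h.mul_nonneg hc hu hx

end IsSolution

/-! ### Quadrants of the angle and bound states -/

theorem sin_mul_cos_sub_int_mul_pi (w : ℝ) (k : ℤ) :
    Real.sin w * Real.cos w = Real.sin (w - k * Real.pi) * Real.cos (w - k * Real.pi) := by
  have h1 := Real.sin_two_mul w
  have h2 := Real.sin_two_mul (w - k * Real.pi)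
  have h3 : Real.sin (2 * (w - k * Real.pi)) = Real.sin (2 * w) := by
    rw [← Real.sin_sub_int_mul_two_pi (2 * w) k]
    congr 1
    ring
  linarith

theorem sin_mul_cos_pos_of_mem {w : ℝ} {k : ℤ} (h1 : k * Real.pi < w)
    (h2 : w < k * Real.pi + Real.pi / 2) : 0 < Real.sin w * Real.cos w := by
  rw [sin_mul_cos_sub_int_mul_pi w k]
  exact mul_pos (Real.sin_pos_of_pos_of_lt_pi (by linarith) (by linarith [Real.pi_pos]))
    (Real.cos_pos_of_mem_Ioo ⟨by linarith [Real.pi_pos], by linarith⟩)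

theorem sin_mul_cos_nonneg_of_mem {w : ℝ} {k : ℤ} (h1 : k * Real.pi ≤ w)
    (h2 : w ≤ k * Real.pi + Real.pi / 2) : 0 ≤ Real.sin w * Real.cos w := by
  rw [sin_mul_cos_sub_int_mul_pi w k]
  exact mul_nonneg (Real.sin_nonneg_of_nonneg_of_le_pi (by linarith) (by linarith [Real.pi_pos]))
    (Real.cos_nonneg_of_mem_Icc ⟨by linarith [Real.pi_pos], by linarith⟩)

theorem sin_mul_cos_nonpos_of_mem {w : ℝ} {k : ℤ} (h1 : k * Real.pi - Real.pi / 2 ≤ w)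
    (h2 : w ≤ k * Real.pi) : Real.sin w * Real.cos w ≤ 0 := by
  have := sin_mul_cos_nonneg_of_mem (w := -w) (k := -k) (by push_cast; linarith)
    (by push_cast; linarith)
  rw [Real.sin_neg, Real.cos_neg] at this
  linarith

theorem sin_mul_sin_pos_of_mem {w z : ℝ} {k : ℤ}
    (hw : w ∈ Set.Ico (k * Real.pi - Real.pi / 2) (k * Real.pi))
    (hz : z ∈ Set.Ico (k * Real.pi - Real.pi / 2) (k * Real.pi)) :
    0 < Real.sin w * Real.sin z := by
  have e : Real.sin w * Real.sin z
      = Real.sin (k * Real.pi - w) * Real.sin (k * Real.pi - z) := by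
    have h := Real.sin_sq_add_cos_sq (k * Real.pi)
    rw [Real.sin_int_mul_pi] at h
    rw [Real.sin_sub, Real.sin_sub, Real.sin_int_mul_pi]
    linear_combination (-(Real.sin w * Real.sin z)) * h
  rw [e]
  exact mul_pos
    (Real.sin_pos_of_pos_of_lt_pi (by linarith [hw.2]) (by linarith [hw.1, Real.pi_pos]))
    (Real.sin_pos_of_pos_of_lt_pi (by linarith [hz.2]) (by linarith [hz.1, Real.pi_pos]))

/-- A continuous angle on a half-line with `sin θ cos θ ≤ 0` stays in a single quadrant. -/
theorem exists_quadrant {θ : ℝ → ℝ} (hθ : Continuous θ) {c : ℝ}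
    (h : ∀ x, c ≤ x → Real.sin (θ x) * Real.cos (θ x) ≤ 0) :
    ∃ m : ℤ, ∀ x, c ≤ x → θ x ∈ Set.Icc (m * Real.pi - Real.pi / 2) (m * Real.pi) := by
  have hπ := Real.pi_pos
  set m : ℤ := ⌈θ c / Real.pi⌉
  have h1 : θ c ≤ m * Real.pi := by
    have := Int.le_ceil (θ c / Real.pi)
    rwa [div_le_iff₀ hπ] at this
  have h2 : m * Real.pi - Real.pi < θ c := by
    have := Int.ceil_lt_add_one (θ c / Real.pi)
    rw [← sub_lt_iff_lt_add, lt_div_iff₀ hπ] at this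
    linarith
  have h3 : m * Real.pi - Real.pi / 2 ≤ θ c := by
    by_contra! h3
    have := sin_mul_cos_pos_of_mem (w := θ c) (k := m - 1) (by push_cast; linarith)
      (by push_cast; linarith)
    linarith [h c le_rfl]
  refine ⟨m, fun x hx => ⟨?_, ?_⟩⟩
  · by_contra! hlt
    -- Leaving the quadrant means entering a neighbouring open quadrant, where `sin cos > 0`.
    -- Clamping at its midpoint produces a value inside it that is attained.
    obtain ⟨y, hy, hyw⟩ := intermediate_value_Icc' hx hθ.continuousOn
      (show max (θ x) (m * Real.pi - 3 * Real.pi / 4) ∈ Set.Icc (θ x) (θ c) from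
        ⟨le_max_left _ _, max_le (by linarith) (by linarith)⟩)
    have hb1 := le_max_right (θ x) (m * Real.pi - 3 * Real.pi / 4)
    have hb2 : max (θ x) (m * Real.pi - 3 * Real.pi / 4) < m * Real.pi - Real.pi / 2 :=
      max_lt hlt (by linarith)
    have := sin_mul_cos_pos_of_mem (w := θ y) (k := m - 1) (by push_cast; linarith)
      (by push_cast; linarith)
    linarith [h y hy.1]
  · by_contra! hlt
    obtain ⟨y, hy, hyw⟩ := intermediate_value_Icc hx hθ.continuousOn
      (show min (θ x) (m * Real.pi + Real.pi / 4) ∈ Set.Icc (θ c) (θ x) from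
        ⟨le_min (by linarith) (by linarith), min_le_left _ _⟩)
    have hb1 := min_le_right (θ x) (m * Real.pi + Real.pi / 4)
    have hb2 : m * Real.pi < min (θ x) (m * Real.pi + Real.pi / 4) :=
      lt_min hlt (by linarith)
    have := sin_mul_cos_pos_of_mem (w := θ y) (k := m) (by linarith) (by linarith)
    linarith [h y hy.1]

theorem int_eq_of_mem_quadrants {w : ℝ} {m n : ℤ}
    (hm : w ∈ Set.Icc (m * Real.pi - Real.pi / 2) (m * Real.pi))
    (hn : w ∈ Set.Icc (n * Real.pi - Real.pi / 2) (n * Real.pi)) : m = n := by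
  have hπ := Real.pi_pos
  have key : ∀ {m n : ℤ}, w ≤ m * Real.pi → n * Real.pi - Real.pi / 2 ≤ w → n ≤ m := by
    intro m n h1 h2
    by_contra! hlt
    have : (m : ℝ) + 1 ≤ n := by exact_mod_cast hlt
    nlinarith
  exact le_antisymm (key hn.2 hm.1) (key hm.2 hn.1)

/-- A square-integrable solution in Prüfer form, whose angle increases from the quadrant
`[0, π / 2]` on the far left to the quadrant `[n π - π / 2, n π]` on the far right. -/
structure IsBoundState (V : ℝ → ℝ) (E : ℝ) (n : ℤ) (θ r : ℝ → ℝ) : Prop where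
  angle : IsPruferAngle V E θ
  radius_pos : ∀ x, 0 < r x
  solution : IsSolution V E (fun x => r x * Real.sin (θ x)) (fun x => r x * Real.cos (θ x))
  integrable : Integrable fun x => (r x * Real.sin (θ x)) ^ 2
  left : ∀ x, (∀ y, y ≤ x → E ≤ V y) → θ x ∈ Set.Icc 0 (Real.pi / 2)
  right : ∀ x, (∀ y, x ≤ y → E ≤ V y) →
    θ x ∈ Set.Icc (n * Real.pi - Real.pi / 2) (n * Real.pi)

/-- The sign of `u u'` confines the angle to one quadrant on the entire forbidden half-line, so
knowing the quadrant far out determines it from the turning point on. -/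
theorem mem_quadrant_of_tail {V : ℝ → ℝ} {E : ℝ} {n : ℤ} {θ r : ℝ → ℝ} (hθ : Continuous θ)
    (hr : ∀ x, 0 < r x)
    (hs : IsSolution V E (fun x => r x * Real.sin (θ x)) (fun x => r x * Real.cos (θ x)))
    (hi : Integrable fun x => (r x * Real.sin (θ x)) ^ 2)
    (ht : ∀ᶠ x in atTop, θ x ∈ Set.Icc (n * Real.pi - Real.pi / 2) (n * Real.pi)) {x : ℝ}
    (hx : ∀ y, x ≤ y → E ≤ V y) : θ x ∈ Set.Icc (n * Real.pi - Real.pi / 2) (n * Real.pi) := by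
  obtain ⟨m, hm⟩ := exists_quadrant hθ (c := x) fun y hy => by
    have := hs.mul_nonpos hx hi hy
    have hr2 := mul_pos (hr y) (hr y)
    by_contra! hpos
    have := mul_pos hr2 hpos
    linarith
  obtain ⟨y, hy1, hy2⟩ := (ht.and (eventually_ge_atTop x)).exists
  rw [int_eq_of_mem_quadrants hy1 (hm y hy2)]
  exact hm x le_rfl

theorem IsPruferAngle.exists_isBoundState {V : ℝ → ℝ} (hV : IsSingleWell V) {E : ℝ} {n : ℤ}
    {θ : ℝ → ℝ} (hθ : IsPruferAngle V E θ)
    (htop : ∀ᶠ x in atTop, θ x ∈ Set.Icc (n * Real.pi - Real.pi / 2) (n * Real.pi))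
    (hbot : ∀ᶠ x in atBot, θ x ∈ Set.Icc 0 (Real.pi / 2)) : ∃ r, IsBoundState V E n θ r := by
  obtain ⟨r, hr, -, hs⟩ := hθ.exists_solution hV.continuous
  have hi2 := hs.integrable_of_tails hV
    (by
      filter_upwards [htop] with x hx
      have := sin_mul_cos_nonpos_of_mem hx.1 hx.2
      nlinarith [mul_pos (hr x) (hr x)])
    (by
      filter_upwards [hbot] with x hx
      have := sin_mul_cos_nonneg_of_mem (w := θ x) (k := 0) (by simpa using hx.1)
        (by simpa using hx.2)
      nlinarith [mul_pos (hr x) (hr x)])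
  have hi : Integrable fun x => (r x * Real.sin (θ x)) ^ 2 := by
    have := hs.continuous_fst
    refine hi2.mono' (this.pow 2).aestronglyMeasurable (Eventually.of_forall fun x => ?_)
    rw [Real.norm_of_nonneg (sq_nonneg _)]
    exact le_add_of_nonneg_right (sq_nonneg _)
  refine ⟨r, hθ, hr, hs, hi, fun x hx => ?_, fun x hx =>
    mem_quadrant_of_tail hθ.continuous hr hs hi htop hx⟩
  -- The left tail is the right tail of the reflected problem with rotation number `0`; the factor
  -- `-1` absorbs the sign change of the sine.
  have := mem_quadrant_of_tail (n := 0) (V := fun x => V (-x)) (E := E) (θ := fun x => -θ (-x))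
    (r := fun x => r (-x)) hθ.reflect.continuous (fun x => hr _)
    (by
      have := hs.linear_comb hs (-1) 0
      simpa using this.reflect)
    (by simpa using hi.comp_neg)
    (by
      filter_upwards [tendsto_neg_atTop_atBot.eventually hbot] with y hy
      simp only [Int.cast_zero, zero_mul, Set.mem_Icc]
      constructor <;> linarith [hy.1, hy.2])
    (x := -x) (fun y hy => hx (-y) (by linarith))
  simp only [neg_neg, Int.cast_zero, zero_mul, Set.mem_Icc] at this
  constructor <;> linarith [this.1, this.2]

namespace IsSingleWell

variable {V : ℝ → ℝ}

theorem exists_right (hV : IsSingleWell V) (E : ℝ) : ∃ c, ∀ x, c ≤ x → E ≤ V x :=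
  eventually_atTop.1 (hV.tendsto_atTop.eventually (eventually_ge_atTop E))

theorem exists_left (hV : IsSingleWell V) (E : ℝ) : ∃ c, ∀ x, x ≤ c → E ≤ V x :=
  eventually_atBot.1 (hV.tendsto_atBot.eventually (eventually_ge_atTop E))

end IsSingleWell

/-- Every nontrivial square-integrable solution is, up to a constant, a bound state. -/
theorem IsSolution.exists_isBoundState {V : ℝ → ℝ} (hV : IsSingleWell V) {E : ℝ} {u v : ℝ → ℝ}
    (h : IsSolution V E u v) (hu : Integrable fun x => u x ^ 2) {x₀ : ℝ} (h0 : u x₀ ≠ 0) :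
    ∃ (n : ℤ) (θ r : ℝ → ℝ), IsBoundState V E n θ r := by
  obtain ⟨θ, r, hθ, hr, e1, e2⟩ := h.exists_isPruferAngle hV.continuous h0
  obtain ⟨c, hc⟩ := hV.exists_right E
  obtain ⟨d, hd⟩ := hV.exists_left E
  obtain ⟨m, hm⟩ := exists_quadrant hθ.continuous (c := c) fun y hy => by
    have := h.mul_nonpos hc hu hy
    rw [e1, e2] at this
    by_contra! hpos
    have := mul_pos (mul_pos (hr y) (hr y)) hpos
    linarith
  obtain ⟨j, hj⟩ := exists_quadrant hθ.reflect.continuous (c := -d) fun y hy => by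
    have := h.mul_nonneg hd hu (x := -y) (by linarith)
    rw [e1, e2] at this
    rw [Real.sin_neg, Real.cos_neg]
    by_contra! hpos
    have := mul_pos (mul_pos (hr (-y)) (hr (-y))) hpos
    linarith
  -- Reflection puts the left quadrant at `[-jπ, -jπ + π/2]`, so a shift by `jπ` normalises it.
  obtain ⟨s, hs⟩ := (hθ.add_int_mul_pi j).exists_isBoundState hV (n := m + j)
    (by
      filter_upwards [eventually_ge_atTop c] with x hx
      have := hm x hx
      push_cast
      constructor <;> linarith [this.1, this.2])
    (by
      filter_upwards [eventually_le_atBot d] with x hx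
      have := hj (-x) (by linarith)
      simp only [neg_neg] at this
      constructor <;> linarith [this.1, this.2])
  exact ⟨_, _, _, hs⟩

namespace IsBoundState

variable {V : ℝ → ℝ} {E : ℝ} {n : ℤ} {θ r : ℝ → ℝ}

theorem angle_nonneg (hV : IsSingleWell V) (h : IsBoundState V E n θ r) (x : ℝ) : 0 ≤ θ x := by
  obtain ⟨d, hd⟩ := hV.exists_left E
  have := h.angle.int_mul_pi_le hV.continuous 0 (min_le_right d x) (by
    simpa using (h.left (min d x) fun y hy => hd y (hy.trans (min_le_left _ _))).1)
  simpa using this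

theorem angle_le (hV : IsSingleWell V) (h : IsBoundState V E n θ r) (x : ℝ) :
    θ x ≤ n * Real.pi := by
  obtain ⟨c, hc⟩ := hV.exists_right E
  exact h.angle.le_int_mul_pi hV.continuous n (le_max_right c x)
    (h.right (max c x) fun y hy => hc y ((le_max_left _ _).trans hy)).2

theorem angle_pos (hV : IsSingleWell V) (h : IsBoundState V E n θ r) (x : ℝ) : 0 < θ x := by
  have := h.angle.int_mul_pi_lt hV.continuous 0 (sub_one_lt x)
    (by simpa using h.angle_nonneg hV (x - 1))
  simpa using this

theorem angle_lt (hV : IsSingleWell V) (h : IsBoundState V E n θ r) (x : ℝ) :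
    θ x < n * Real.pi := by
  by_contra! hx
  have := h.angle.int_mul_pi_lt hV.continuous n (lt_add_one x) hx
  linarith [h.angle_le hV (x + 1)]

theorem one_le (hV : IsSingleWell V) (h : IsBoundState V E n θ r) : 1 ≤ n := by
  have h1 := (h.angle_pos hV 0).trans (h.angle_lt hV 0)
  have : (0 : ℝ) < n := by
    by_contra! hn
    nlinarith [Real.pi_pos]
  exact_mod_cast this

/-- For `E ≤ 0` the whole line is forbidden, so both quadrant conditions hold everywhere and, as `n
≥ 1`, pin `θ` to `π/2`. The Prüfer equation then makes `V` constant. -/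
theorem energy_pos (hV : IsSingleWell V) (h : IsBoundState V E n θ r) : 0 < E := by
  by_contra! hE
  have hVE : ∀ y, E ≤ V y := fun y => hE.trans (hV.nonneg y)
  have hn : (1 : ℝ) ≤ n := by exact_mod_cast h.one_le hV
  have hconst : θ = fun _ => Real.pi / 2 := by
    funext x
    have h1 := (h.left x fun y _ => hVE y).2
    have h2 := (h.right x fun y _ => hVE y).1
    nlinarith [Real.pi_pos]
  have hVx : ∀ x, V x = E := by
    intro x
    have h1 := h.angle x
    rw [hconst] at h1
    have h2 := h1.unique (hasDerivAt_const x _)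
    simp only [pruferField, Real.cos_pi_div_two, Real.sin_pi_div_two] at h2
    linarith
  have := hV.strictMonoOn (a := 0) (b := 1) (by simp) (by simp) one_pos
  rw [hVx, hVx] at this
  exact lt_irrefl _ this

end IsBoundState

/-! ### Ordering of bound states by Wronskians -/

theorem IsSolution.integrable_wronskian {V : ℝ → ℝ} (hV : IsSingleWell V) {E E' : ℝ}
    {u v u' v' : ℝ → ℝ} (h : IsSolution V E u v) (h' : IsSolution V E' u' v')
    (hu : Integrable fun x => u x ^ 2) (hu' : Integrable fun x => u' x ^ 2) :
    Integrable fun x => u x * v' x - v x * u' x := by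
  have c1 := h.continuous_fst
  have c2 := h.continuous_snd
  have c3 := h'.continuous_fst
  have c4 := h'.continuous_snd
  refine ((hu.add (h.integrable_snd hV hu)).add
    (hu'.add (h'.integrable_snd hV hu'))).mono' (by fun_prop) (Eventually.of_forall fun x => ?_)
  simp only [Pi.add_apply, Real.norm_eq_abs, abs_le]
  constructor <;> nlinarith [sq_nonneg (u x + v' x), sq_nonneg (u x - v' x),
    sq_nonneg (v x + u' x), sq_nonneg (v x - u' x)]

/-- Decaying solutions with angles in the same quadrant have angles decreasing in the energy. -/
theorem angle_lt_of_energy_lt {V : ℝ → ℝ} (hV : IsSingleWell V) {E E' : ℝ} (hE : E < E') {n : ℤ}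
    {θ r φ s : ℝ → ℝ} (hr : ∀ x, 0 < r x) (hs : ∀ x, 0 < s x)
    (h : IsSolution V E (fun x => r x * Real.sin (θ x)) (fun x => r x * Real.cos (θ x)))
    (h' : IsSolution V E' (fun x => s x * Real.sin (φ x)) (fun x => s x * Real.cos (φ x)))
    (hi : Integrable fun x => (r x * Real.sin (θ x)) ^ 2)
    (hi' : Integrable fun x => (s x * Real.sin (φ x)) ^ 2) {c : ℝ}
    (hθ : ∀ x, c ≤ x → θ x ∈ Set.Ico (n * Real.pi - Real.pi / 2) (n * Real.pi))
    (hφ : ∀ x, c ≤ x → φ x ∈ Set.Ico (n * Real.pi - Real.pi / 2) (n * Real.pi)) :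
    φ c < θ c := by
  have hW := h.integrable_wronskian hV h' hi hi'
  set W : ℝ → ℝ := fun x => r x * Real.sin (θ x) * (s x * Real.cos (φ x))
    - r x * Real.cos (θ x) * (s x * Real.sin (φ x)) with hWdef
  have hd := h.hasDerivAt_wronskian h'
  -- `W = r s sin (θ - φ)`, and `W'` is `E - E'` times a product of two solutions of the same sign.
  -- Being decreasing and integrable, `W` cannot become negative, so `W c > 0`.
  have hanti : StrictAntiOn W (Set.Ici c) := by
    refine strictAntiOn_of_deriv_neg (convex_Ici c)
      (fun x _ => (hd x).continuousAt.continuousWithinAt) fun x hx => ?_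
    rw [interior_Ici] at hx
    rw [(hd x).deriv]
    have h1 := sin_mul_sin_pos_of_mem (hθ x (le_of_lt hx)) (hφ x (le_of_lt hx))
    have h2 := mul_pos (mul_pos (hr x) (hs x)) h1
    nlinarith
  have hnn : 0 ≤ W (c + 1) := by
    have := nonpos_of_le_of_integrableOn (c := c + 1) (δ := -W (c + 1)) hW.neg.integrableOn
      fun x hx => neg_le_neg (hanti.antitoneOn (Set.mem_Ici.2 (by linarith))
        (Set.mem_Ici.2 (by linarith)) hx.le)
    linarith
  have hpos : 0 < W c := lt_of_le_of_lt hnn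
    (hanti Set.self_mem_Ici (Set.mem_Ici.2 (by linarith)) (by linarith))
  by_contra! hle
  have h1 : 0 ≤ Real.sin (φ c - θ c) :=
    Real.sin_nonneg_of_nonneg_of_le_pi (by linarith)
      (by linarith [(hφ c le_rfl).2, (hθ c le_rfl).1, Real.pi_pos])
  rw [Real.sin_sub] at h1
  have h2 := mul_nonneg (mul_pos (hr c) (hs c)).le h1
  simp only [hWdef] at hpos
  linarith

/-- Distinct bound-state energies have distinct rotation numbers, ordered in the same way. -/
theorem IsBoundState.lt_of_energy_lt {V : ℝ → ℝ} (hV : IsSingleWell V) {E E' : ℝ} {n n' : ℤ}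
    {θ r φ s : ℝ → ℝ} (h : IsBoundState V E n θ r) (h' : IsBoundState V E' n' φ s)
    (hE : E < E') : n < n' := by
  obtain ⟨c, hc⟩ := hV.exists_right E'
  obtain ⟨d, hd⟩ := hV.exists_left E'
  have hleft : θ d < φ d := by
    have := angle_lt_of_energy_lt hV.reflect hE (n := 0) (θ := fun x => -θ (-x))
      (φ := fun x => -φ (-x)) (r := fun x => r (-x)) (s := fun x => s (-x)) (c := -d)
      (fun x => h.radius_pos _) (fun x => h'.radius_pos _)
      (by simpa using (h.solution.linear_comb h.solution (-1) 0).reflect)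
      (by simpa using (h'.solution.linear_comb h'.solution (-1) 0).reflect)
      (by simpa using h.integrable.comp_neg) (by simpa using h'.integrable.comp_neg)
      (fun x hx => by
        have h1 := h.left (-x) fun y hy => hE.le.trans (hd y (by linarith))
        have h2 := h.angle_pos hV (-x)
        simp only [Int.cast_zero, zero_mul]
        constructor <;> linarith [h1.2])
      (fun x hx => by
        have h1 := h'.left (-x) fun y hy => hd y (by linarith)
        have h2 := h'.angle_pos hV (-x)
        simp only [Int.cast_zero, zero_mul]
        constructor <;> linarith [h1.2])
    simp only [neg_neg] at this
    linarith
  -- Comparison carries the order from the left tail to the right one. There `n > n'` would put `θ`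
  -- above `φ` by quadrants, and `n = n'` by the Wronskian argument.
  have hle : ∀ x, d ≤ x → θ x ≤ φ x := fun x hx =>
    h.angle.le_of_le hV.continuous h'.angle hE.le hx hleft.le
  by_contra! hn
  rcases hn.lt_or_eq with hlt | rfl
  · have h1 : (n' : ℝ) + 1 ≤ n := by exact_mod_cast hlt
    have h2 := (h.right (max c d) fun y hy => hE.le.trans (hc y ((le_max_left _ _).trans hy))).1
    have h3 := h'.angle_le hV (max c d)
    have h4 := hle _ (le_max_right c d)
    nlinarith [Real.pi_pos]
  · have := angle_lt_of_energy_lt hV hE (n := n') (c := max c d) h.radius_pos h'.radius_pos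
      h.solution h'.solution h.integrable h'.integrable
      (fun x hx => ⟨(h.right x fun y hy =>
        hE.le.trans (hc y ((le_max_left _ _).trans (hx.trans hy)))).1, h.angle_lt hV x⟩)
      (fun x hx => ⟨(h'.right x fun y hy => hc y ((le_max_left _ _).trans (hx.trans hy))).1,
        h'.angle_lt hV x⟩)
    linarith [hle _ (le_max_right c d)]

/-- The rotation number of a bound state is determined by its energy. -/
theorem IsBoundState.rotation_unique {V : ℝ → ℝ} (hV : IsSingleWell V) {E : ℝ} {n n' : ℤ}
    {θ r φ s : ℝ → ℝ} (h : IsBoundState V E n θ r) (h' : IsBoundState V E n' φ s) : n = n' := by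
  obtain ⟨c, hc⟩ := hV.exists_right E
  obtain ⟨d, hd⟩ := hV.exists_left E
  have hW := h.solution.integrable_wronskian hV h'.solution h.integrable h'.integrable
  have hconst := h.solution.wronskian_eq h'.solution
  -- At equal energies the Wronskian is constant and integrable, hence zero, so `sin (φ - θ)`
  -- vanishes.
  have h1 := nonpos_of_le_of_integrableOn hW.integrableOn (c := 0) fun x _ => (hconst x).ge
  have h2 := nonpos_of_le_of_integrableOn hW.neg.integrableOn (c := 0) fun x _ =>
    (neg_le_neg (hconst x).le)
  have h0 : r d * s d * Real.sin (φ d - θ d) = 0 := by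
    rw [Real.sin_sub]
    have := hconst d
    linarith
  have hsin := (mul_eq_zero.1 h0).resolve_left
    (mul_pos (h.radius_pos d) (h'.radius_pos d)).ne'
  have hθ := h.left d fun y hy => hd y hy
  have hφ := h'.left d fun y hy => hd y hy
  have heq : θ d = φ d := by
    have := (Real.sin_eq_zero_iff_of_lt_of_lt
      (by linarith [hθ.2, h'.angle_pos hV d, Real.pi_pos])
      (by linarith [hφ.2, h.angle_pos hV d, Real.pi_pos])).1 hsin
    linarith
  rw [h.angle.unique hV.continuous h'.angle heq] at h
  exact int_eq_of_mem_quadrants (h.right c hc) (h'.right c hc)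

/-! ### Existence of bound states -/

/-- Shooting: the final angle depends continuously on the energy. At energy `0` the line is
forbidden and the angle stays below `π/2`; at `M + 1` it has slope at least `1` on an interval of
length `2nπ`. The energy window does not depend on `L`, which the limit `L → ∞` needs. -/
theorem exists_dirichlet_angle {V : ℝ → ℝ} (hV : IsSingleWell V) {n : ℕ} (hn : 1 ≤ n) {M : ℝ}
    (hM : ∀ x ∈ Set.Icc (-(n * Real.pi)) (n * Real.pi), V x ≤ M) {L : ℝ} (hL : n * Real.pi ≤ L) :
    ∃ E ∈ Set.Icc 0 (M + 1), ∃ θ, IsPruferAngle V E θ ∧ θ (-L) = 0 ∧ θ L = n * Real.pi := by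
  have hπ := Real.pi_pos
  have hn' : (1 : ℝ) ≤ n := by exact_mod_cast hn
  have hnπ : Real.pi ≤ n * Real.pi := by nlinarith
  have hM0 : 0 ≤ M := (hV.nonneg 0).trans (hM 0 ⟨by linarith, by linarith⟩)
  choose θ hθ0 hθ using fun E => exists_isPruferAngle hV.continuous E (-L) 0
  have hcont : Continuous fun E => θ E L := by
    refine continuous_iff_continuousAt.2 fun E => ?_
    exact (hθ E).tendsto hV.continuous hθ tendsto_id (a := -L) (by simp [hθ0]) L
  have h0 : θ 0 L ≤ n * Real.pi := by
    have := (hθ 0).le_half_pi hV.continuous 0 (a := -L) (b := L) (by linarith)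
      (fun x _ => hV.nonneg x) (by rw [hθ0]; simp; linarith)
    simp only [Int.cast_zero, zero_mul, zero_add] at this
    linarith
  have h1 : n * Real.pi ≤ θ (M + 1) L := by
    have h2 : 0 ≤ θ (M + 1) (-(n * Real.pi)) := by
      simpa using (hθ (M + 1)).int_mul_pi_le hV.continuous 0 (a := -L) (b := -(n * Real.pi))
        (by linarith) (by simp [hθ0])
    have hmono : MonotoneOn (fun x => θ (M + 1) x - x)
        (Set.Icc (-(n * Real.pi)) (n * Real.pi)) := by
      have hd := fun x => ((hθ (M + 1)) x).sub (hasDerivAt_id x)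
      refine monotoneOn_of_deriv_nonneg (convex_Icc _ _)
        (fun x _ => (hd x).continuousAt.continuousWithinAt)
        (fun x _ => (hd x).differentiableAt.differentiableWithinAt) fun x hx => ?_
      rw [interior_Icc] at hx
      have := (hd x).deriv
      simp only [Pi.sub_def, id] at this
      rw [this]
      have h3 := hM x ⟨hx.1.le, hx.2.le⟩
      simp only [pruferField, Real.cos_sq']
      nlinarith [sq_nonneg (Real.sin (θ (M + 1) x))]
    have h3 := hmono ⟨le_rfl, by linarith⟩ ⟨by linarith, le_rfl⟩
      (show -(n * Real.pi) ≤ n * Real.pi by linarith)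
    simp only at h3
    have := (hθ (M + 1)).int_mul_pi_le hV.continuous n (a := n * Real.pi) (b := L) hL
      (by push_cast; linarith)
    simpa using this
  obtain ⟨E, hE, hEL⟩ := intermediate_value_Icc (show (0 : ℝ) ≤ M + 1 by linarith)
    hcont.continuousOn ⟨h0, h1⟩
  exact ⟨E, hE, θ E, hθ E, hθ0 E, hEL⟩

/-- Bound states exist for every rotation number. -/
theorem exists_isBoundState {V : ℝ → ℝ} (hV : IsSingleWell V) {n : ℕ} (hn : 1 ≤ n) :
    ∃ (E : ℝ) (θ r : ℝ → ℝ), IsBoundState V E n θ r := by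
  have hπ := Real.pi_pos
  obtain ⟨M, hM⟩ := isCompact_Icc.exists_bound_of_continuousOn
    (s := Set.Icc (-(n * Real.pi)) (n * Real.pi)) hV.continuous.continuousOn
  have hM' : ∀ x ∈ Set.Icc (-(n * Real.pi)) (n * Real.pi), V x ≤ M := fun x hx =>
    (le_abs_self _).trans (hM x hx)
  choose Es hEs θs hθs hθs0 hθs1 using fun j : ℕ =>
    exists_dirichlet_angle hV hn hM' (L := n * Real.pi + j) (by simp)
  have hnπ : 0 ≤ n * Real.pi := by positivity
  have hlow : ∀ (j : ℕ) (x : ℝ), -(n * Real.pi + j) ≤ x → 0 ≤ θs j x := fun j x hx => by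
    simpa using (hθs j).int_mul_pi_le hV.continuous 0 hx (by rw [hθs0]; simp)
  have hupp : ∀ (j : ℕ) (x : ℝ), x ≤ n * Real.pi + j → θs j x ≤ n * Real.pi := fun j x hx => by
    simpa using (hθs j).le_int_mul_pi hV.continuous n hx (by simp [hθs1])
  have hmem : ∀ j, (Es j, θs j 0) ∈ Set.Icc 0 (M + 1) ×ˢ Set.Icc 0 (n * Real.pi) := fun j =>
    ⟨hEs j, hlow j 0 (by linarith [(Nat.cast_nonneg j : (0 : ℝ) ≤ j)]), hupp j 0 (by positivity)⟩
  -- Energies and angles at `0` stay in a compact rectangle; a limit point supplies the energy and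
  -- the initial value.
  obtain ⟨⟨E, y⟩, -, k, hk, hlim⟩ :=
    (isCompact_Icc.prod isCompact_Icc).tendsto_subseq hmem
  obtain ⟨θ, hθ0, hθ⟩ := exists_isPruferAngle hV.continuous E 0 y
  have hlimE : Tendsto (fun j => Es (k j)) atTop (𝓝 E) := (continuous_fst.tendsto _).comp hlim
  have hlim0 : Tendsto (fun j => θs (k j) 0) atTop (𝓝 (θ 0)) := by
    rw [hθ0]
    exact (continuous_snd.tendsto _).comp hlim
  have hconv := hθ.tendsto hV.continuous (fun j => hθs (k j)) hlimE hlim0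
  have hlarge : ∀ x : ℝ, ∀ᶠ j in atTop, x ≤ n * Real.pi + (k j : ℝ) := fun x => by
    have : Tendsto (fun j => (k j : ℝ)) atTop atTop :=
      tendsto_natCast_atTop_atTop.comp hk.tendsto_atTop
    filter_upwards [this.eventually (eventually_ge_atTop x)] with j hj
    linarith
  obtain ⟨c, hc⟩ := hV.exists_right (M + 1)
  obtain ⟨d, hd⟩ := hV.exists_left (M + 1)
  refine ⟨E, θ, hθ.exists_isBoundState hV ?_ ?_⟩
  · filter_upwards [eventually_ge_atTop c] with x hx
    refine isClosed_Icc.mem_of_tendsto (hconv x) ?_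
    filter_upwards [hlarge x] with j hj
    refine ⟨?_, by simpa using hupp _ _ hj⟩
    -- In the region forbidden for all the approximating energies, an angle below `nπ - π/2` could
    -- not climb to its boundary value `nπ`.
    by_contra! hlt
    have := (hθs (k j)).le_half_pi hV.continuous (n - 1) hj
      (fun z hz => (hEs _).2.trans (hc z (hx.trans hz.1))) (by push_cast at hlt ⊢; linarith)
    rw [hθs1] at this
    push_cast at this
    linarith
  · filter_upwards [eventually_le_atBot d] with x hx
    refine isClosed_Icc.mem_of_tendsto (hconv x) ?_
    filter_upwards [hlarge (-x)] with j hj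
    refine ⟨hlow _ _ (by linarith), ?_⟩
    have := (hθs (k j)).le_half_pi hV.continuous 0 (show -(n * Real.pi + (k j : ℝ)) ≤ x by linarith)
      (fun z hz => (hEs _).2.trans (hd z (hz.2.trans hx))) (by rw [hθs0]; simp; linarith)
    simpa using this

/-! ### Sublevel intervals and the rescaled angle -/

/-- Sublevel sets of a single-well potential are intervals. -/
theorem IsSingleWell.exists_sublevel {V : ℝ → ℝ} (hV : IsSingleWell V) {c : ℝ} (hc : 0 < c) :
    ∃ a b : ℝ, a ≤ b ∧ (∀ x, x ≤ a → c ≤ V x) ∧ (∀ x, b ≤ x → c ≤ V x) ∧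
      (∀ x ∈ Set.Icc a b, V x ≤ c) ∧ volume.real {x : ℝ | V x < c} = b - a := by
  have half : ∀ {V : ℝ → ℝ}, IsSingleWell V → ∃ b, 0 ≤ b ∧ V b = c := by
    intro V hV
    obtain ⟨T, hT1, hT2⟩ := ((hV.tendsto_atTop.eventually (eventually_ge_atTop c)).and
      (eventually_ge_atTop 0)).exists
    obtain ⟨b, hb, hbc⟩ := intermediate_value_Icc hT2 hV.continuous.continuousOn
      (show c ∈ Set.Icc (V 0) (V T) by rw [hV.zero]; exact ⟨hc.le, hT1⟩)
    exact ⟨b, hb.1, hbc⟩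
  obtain ⟨b, hb0, hbc⟩ := half hV
  obtain ⟨a, ha0, hac⟩ := half hV.reflect
  have hR : ∀ x, b ≤ x → c ≤ V x := fun x hx => hbc ▸
    hV.strictMonoOn.monotoneOn hb0 (Set.mem_Ici.2 (hb0.trans hx)) hx
  have hL : ∀ x, x ≤ -a → c ≤ V x := fun x hx => hac ▸
    hV.strictAntiOn.antitoneOn (Set.mem_Iic.2 (by linarith)) (Set.mem_Iic.2 (by linarith)) hx
  have hin : ∀ x ∈ Set.Icc (-a) b, V x ≤ c := by
    intro x hx
    rcases le_total 0 x with h | h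
    · exact hbc ▸ hV.strictMonoOn.monotoneOn h hb0 hx.2
    · exact hac ▸ hV.strictAntiOn.antitoneOn (Set.mem_Iic.2 (by linarith)) h hx.1
  have hset : {x : ℝ | V x < c} = Set.Ioo (-a) b := by
    ext x
    simp only [Set.mem_ofPred_eq, Set.mem_Ioo]
    constructor
    · intro h
      constructor
      · by_contra! h'
        linarith [hL x h']
      · by_contra! h'
        linarith [hR x h']
    · rintro ⟨h1, h2⟩
      rcases le_total 0 x with h | h
      · exact hbc ▸ hV.strictMonoOn h hb0 h2
      · exact hac ▸ hV.strictAntiOn (Set.mem_Iic.2 (by linarith)) h h1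
  refine ⟨-a, b, by linarith, hL, hR, hin, ?_⟩
  rw [hset, Real.volume_real_Ioo_of_le (by linarith)]

/-- The angle `φ` in the same quadrant as `θ` with `tan φ = k tan θ`. -/
noncomputable def scaledAngle (k θ : ℝ) : ℝ :=
  θ + Real.arctan ((k - 1) * Real.sin θ * Real.cos θ / (Real.cos θ ^ 2 + k * Real.sin θ ^ 2))

theorem cos_sq_add_mul_sin_sq_pos {k : ℝ} (hk : 0 < k) (θ : ℝ) :
    0 < Real.cos θ ^ 2 + k * Real.sin θ ^ 2 := by
  have h := Real.sin_sq_add_cos_sq θ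
  rcases (sq_nonneg (Real.sin θ)).eq_or_lt with h0 | h0
  · rw [← h0] at h ⊢
    linarith
  · positivity

/-- This is what differentiating `tan φ = k tan θ` gives; writing `φ - θ` as an arctangent with
positive denominator avoids the poles of the tangent. -/
theorem hasDerivAt_scaledAngle {k : ℝ} (hk : 0 < k) (θ : ℝ) :
    HasDerivAt (scaledAngle k) (k / (Real.cos θ ^ 2 + k ^ 2 * Real.sin θ ^ 2)) θ := by
  have hD := cos_sq_add_mul_sin_sq_pos hk θ
  have hD2 := cos_sq_add_mul_sin_sq_pos (pow_pos hk 2) θ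
  have h := (hasDerivAt_id θ).add (((((Real.hasDerivAt_sin θ).const_mul (k - 1)).mul
    (Real.hasDerivAt_cos θ)).div (((Real.hasDerivAt_cos θ).pow 2).add
      (((Real.hasDerivAt_sin θ).pow 2).const_mul k)) hD.ne').arctan)
  convert! h using 1
  simp only [Pi.pow_apply, Pi.mul_apply, Pi.add_apply, Pi.div_apply]
  push_cast
  set s := Real.sin θ
  set c := Real.cos θ
  have hsc : s ^ 2 = 1 - c ^ 2 := Real.sin_sq θ
  have hN : (c ^ 2 + k * s ^ 2) ^ 2 + ((k - 1) * s * c) ^ 2 = c ^ 2 + k ^ 2 * s ^ 2 := by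
    linear_combination (c ^ 2 + k ^ 2 * s ^ 2) * hsc
  have e1 : 1 + ((k - 1) * s * c / (c ^ 2 + k * s ^ 2)) ^ 2
      = (c ^ 2 + k ^ 2 * s ^ 2) / (c ^ 2 + k * s ^ 2) ^ 2 := by
    rw [← hN]
    field_simp
  rw [e1]
  field_simp
  have hc : c ^ 2 = 1 - s ^ 2 := by linarith
  have hc3 : c ^ 3 = c * (1 - s ^ 2) := by rw [← hc]; ring
  have hc4 : c ^ 4 = (1 - s ^ 2) ^ 2 := by rw [← hc]; ring
  ring_nf
  simp only [hc, hc4]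
  ring

theorem strictMono_scaledAngle {k : ℝ} (hk : 0 < k) : StrictMono (scaledAngle k) :=
  strictMono_of_deriv_pos fun θ => by
    rw [(hasDerivAt_scaledAngle hk θ).deriv]
    exact div_pos hk (cos_sq_add_mul_sin_sq_pos (pow_pos hk 2) θ)

theorem scaledAngle_int_mul_pi (k : ℝ) (m : ℤ) : scaledAngle k (m * Real.pi) = m * Real.pi := by
  simp [scaledAngle, Real.sin_int_mul_pi]

theorem scaledAngle_zero (k : ℝ) : scaledAngle k 0 = 0 := by
  simp [scaledAngle]

theorem scaledAngle_add_half_pi (k : ℝ) (m : ℤ) :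
    scaledAngle k (m * Real.pi + Real.pi / 2) = m * Real.pi + Real.pi / 2 := by
  simp [scaledAngle, Real.cos_add_pi_div_two, Real.sin_int_mul_pi]

theorem scaledAngle_half_pi (k : ℝ) : scaledAngle k (Real.pi / 2) = Real.pi / 2 := by
  simp [scaledAngle]

theorem sin_scaledAngle_mul_cos {k : ℝ} (hk : 0 < k) (θ : ℝ) :
    Real.sin (scaledAngle k θ) * Real.cos θ = k * (Real.sin θ * Real.cos (scaledAngle k θ)) := by
  have hD := cos_sq_add_mul_sin_sq_pos hk θ
  set z := (k - 1) * Real.sin θ * Real.cos θ / (Real.cos θ ^ 2 + k * Real.sin θ ^ 2) with hz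
  have hzD : z * (Real.cos θ ^ 2 + k * Real.sin θ ^ 2) = (k - 1) * Real.sin θ * Real.cos θ :=
    div_mul_cancel₀ _ hD.ne'
  have hs : Real.sin (Real.arctan z) = z * Real.cos (Real.arctan z) := by
    rw [Real.sin_arctan, Real.cos_arctan]
    ring
  simp only [scaledAngle]
  rw [← hz, Real.sin_add, Real.cos_add, hs]
  linear_combination Real.cos (Real.arctan z) * hzD

theorem IsPruferAngle.hasDerivAt_scaledAngle {V : ℝ → ℝ} {E : ℝ} {θ : ℝ → ℝ}
    (hθ : IsPruferAngle V E θ) {k : ℝ} (hk : 0 < k) (x : ℝ) :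
    HasDerivAt (fun x => scaledAngle k (θ x))
      (k / (Real.cos (θ x) ^ 2 + k ^ 2 * Real.sin (θ x) ^ 2) * pruferField V E x (θ x)) x :=
  (_root_.hasDerivAt_scaledAngle hk (θ x)).comp x (hθ x)

/-- The chain rule gives `φ' = k (cos² θ + (E - V) sin² θ) / (cos² θ + k² sin² θ)`, so comparing `E
- V` with `k²` compares `φ'` with `k`. -/
theorem IsPruferAngle.scaledAngle_sub_le {V : ℝ → ℝ} {E : ℝ} {θ : ℝ → ℝ}
    (hθ : IsPruferAngle V E θ) {k a b : ℝ} (hk : 0 < k) (hab : a ≤ b)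
    (h : ∀ x ∈ Set.Icc a b, E - V x ≤ k ^ 2) :
    scaledAngle k (θ b) - scaledAngle k (θ a) ≤ k * (b - a) := by
  have hd := hθ.hasDerivAt_scaledAngle hk
  refine Convex.image_sub_le_mul_sub_of_deriv_le (convex_Icc a b)
    (fun x _ => (hd x).continuousAt.continuousWithinAt)
    (fun x _ => (hd x).differentiableAt.differentiableWithinAt) (fun x hx => ?_)
    a ⟨le_rfl, hab⟩ b ⟨hab, le_rfl⟩ hab
  rw [interior_Icc] at hx
  rw [(hd x).deriv, div_mul_eq_mul_div, div_le_iff₀ (cos_sq_add_mul_sin_sq_pos (pow_pos hk 2) _)]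
  have := h x ⟨hx.1.le, hx.2.le⟩
  unfold pruferField
  gcongr

theorem IsPruferAngle.le_scaledAngle_sub {V : ℝ → ℝ} {E : ℝ} {θ : ℝ → ℝ}
    (hθ : IsPruferAngle V E θ) {k a b : ℝ} (hk : 0 < k) (hab : a ≤ b)
    (h : ∀ x ∈ Set.Icc a b, k ^ 2 ≤ E - V x) :
    k * (b - a) ≤ scaledAngle k (θ b) - scaledAngle k (θ a) := by
  have hd := hθ.hasDerivAt_scaledAngle hk
  refine Convex.mul_sub_le_image_sub_of_le_deriv (convex_Icc a b)
    (fun x _ => (hd x).continuousAt.continuousWithinAt)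
    (fun x _ => (hd x).differentiableAt.differentiableWithinAt) (fun x hx => ?_)
    a ⟨le_rfl, hab⟩ b ⟨hab, le_rfl⟩ hab
  rw [interior_Icc] at hx
  rw [(hd x).deriv, div_mul_eq_mul_div, le_div_iff₀ (cos_sq_add_mul_sin_sq_pos (pow_pos hk 2) _)]
  have := h x ⟨hx.1.le, hx.2.le⟩
  unfold pruferField
  gcongr

/-! ### The three Bohr–Sommerfeld inequalities -/

namespace IsBoundState

variable {V : ℝ → ℝ} {E : ℝ} {n : ℤ} {θ r : ℝ → ℝ}

/-- Take `k = √E`, admissible since `V ≥ 0`. Between the turning points the angle passes from at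
most `π/2` to at least `(n-1)π + π/2`, both fixed by the rescaling. -/
theorem pi_mul_sub_one_le (hV : IsSingleWell V) (h : IsBoundState V E n θ r) :
    Real.pi * (n - 1) ≤ Real.sqrt E * volume.real {x : ℝ | V x < E} := by
  have hE := h.energy_pos hV
  obtain ⟨a, b, hab, hL, hR, -, hvol⟩ := hV.exists_sublevel hE
  have hk : 0 < Real.sqrt E := Real.sqrt_pos.2 hE
  have h1 := h.angle.scaledAngle_sub_le hk hab fun x _ => by
    rw [Real.sq_sqrt hE.le]
    linarith [hV.nonneg x]
  have h2 := (strictMono_scaledAngle hk).monotone (h.left a hL).2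
  have h3 := (strictMono_scaledAngle hk).monotone
    (show ((n - 1 : ℤ) : ℝ) * Real.pi + Real.pi / 2 ≤ θ b by
      push_cast
      linarith [(h.right b hR).1])
  rw [scaledAngle_half_pi] at h2
  rw [scaledAngle_add_half_pi] at h3
  push_cast at h3
  rw [hvol]
  linarith

theorem sqrt_mul_volume_le (hV : IsSingleWell V) (h : IsBoundState V E n θ r) {t : ℝ}
    (ht : 0 < t) :
    Real.sqrt (E / (1 + t)) * volume.real {x : ℝ | V x < E / (1 + t)}
      ≤ Real.pi * n / Real.sqrt t := by
  have hE := h.energy_pos hV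
  have hc : 0 < E / (1 + t) := by positivity
  have hcE : E = E / (1 + t) + t * (E / (1 + t)) := by field_simp
  obtain ⟨a, b, hab, -, -, hin, hvol⟩ := hV.exists_sublevel hc
  -- On the sublevel interval `E - V ≥ tE/(1+t)`, which is the choice of `k²`.
  have hk : 0 < Real.sqrt (t * (E / (1 + t))) := Real.sqrt_pos.2 (by positivity)
  have h1 := h.angle.le_scaledAngle_sub hk hab fun x hx => by
    rw [Real.sq_sqrt (by positivity)]
    linarith [hin x hx]
  have h2 := (strictMono_scaledAngle hk).monotone (h.angle_nonneg hV a)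
  have h3 := (strictMono_scaledAngle hk).monotone (h.angle_le hV b)
  rw [scaledAngle_zero] at h2
  rw [scaledAngle_int_mul_pi] at h3
  rw [Real.sqrt_mul ht.le] at h1 h2 h3
  rw [hvol, le_div_iff₀ (Real.sqrt_pos.2 ht)]
  linarith

/-- In terms of tangents: `S/C = √E s/c` and the decay bound give `(S/C)² ≤ ε²/(1 - ε²)`. The form
without quotients also covers `c = 0` and `C = 0`. -/
theorem sin_scaledAngle_sq_le {s c S C ε E : ℝ} (hE : 0 < E) (hε : 0 < ε)
    (hs : s ≠ 0) (hSC : S ^ 2 + C ^ 2 = 1) (htan : S * c = Real.sqrt E * (s * C))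
    (hcs : ((ε ^ 2)⁻¹ * E - E) * s ^ 2 ≤ c ^ 2) : S ^ 2 ≤ ε ^ 2 := by
  have h1 : S ^ 2 * c ^ 2 = E * s ^ 2 * C ^ 2 := by
    have := congrArg (· ^ 2) htan
    simp only [mul_pow, Real.sq_sqrt hE.le] at this
    linarith
  have h2 : S ^ 2 * (((ε ^ 2)⁻¹ * E - E) * s ^ 2) ≤ S ^ 2 * c ^ 2 := by gcongr
  have hpos : 0 < E * s ^ 2 := by positivity
  have h3 : (E * s ^ 2) * (S ^ 2 * (ε ^ 2)⁻¹) ≤ (E * s ^ 2) * 1 := by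
    have : C ^ 2 = 1 - S ^ 2 := by linarith
    rw [this] at h1
    linarith
  have h4 := le_of_mul_le_mul_left h3 hpos
  rwa [← div_eq_mul_inv, div_le_one (by positivity)] at h4

/-- At the edges of `{V < ε⁻²E}` decay at rate `(ε⁻² - 1)E` makes the rescaled angle close to `0` on
the left and to `π` on the right, each within `πε/2`. -/
theorem pi_mul_one_sub_le (hV : IsSingleWell V) (h : IsBoundState V E 1 θ r) {ε : ℝ}
    (hε : 0 < ε) (hε1 : ε < 1) :
    Real.pi * (1 - ε) ≤ Real.sqrt E * volume.real {x : ℝ | V x < (ε ^ 2)⁻¹ * E} := by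
  have hπ := Real.pi_pos
  have hE := h.energy_pos hV
  have hinv : 1 ≤ (ε ^ 2)⁻¹ := (one_le_inv₀ (by positivity)).2 (by nlinarith)
  have hEc : E ≤ (ε ^ 2)⁻¹ * E := by nlinarith
  obtain ⟨a, b, hab, hL, hR, -, hvol⟩ := hV.exists_sublevel (c := (ε ^ 2)⁻¹ * E) (by positivity)
  have hk : 0 < Real.sqrt E := Real.sqrt_pos.2 hE
  have h1 := h.angle.scaledAngle_sub_le hk hab fun x _ => by
    rw [Real.sq_sqrt hE.le]
    linarith [hV.nonneg x]
  have hsin : ∀ x, Real.sin (θ x) ≠ 0 := fun x =>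
    (Real.sin_pos_of_pos_of_lt_pi (h.angle_pos hV x) (by simpa using h.angle_lt hV x)).ne'
  have key : ∀ x, ((ε ^ 2)⁻¹ * E - E) * (r x * Real.sin (θ x)) ^ 2 ≤ (r x * Real.cos (θ x)) ^ 2 →
      Real.sin (scaledAngle (Real.sqrt E) (θ x)) ≤ ε := by
    intro x hx
    refine abs_le_of_sq_le_sq' ?_ hε.le |>.2
    refine sin_scaledAngle_sq_le hE hε (hsin x) (Real.sin_sq_add_cos_sq _)
      (sin_scaledAngle_mul_cos hk (θ x)) ?_
    have hr : 0 < r x ^ 2 := pow_pos (h.radius_pos x) 2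
    refine le_of_mul_le_mul_left ?_ hr
    linarith
  have hb := key b (h.solution.mul_sq_le_sq (by linarith) (fun x hx => by linarith [hR x hx])
    h.integrable.integrableOn)
  have ha := key a (by
    have := h.solution.reflect.mul_sq_le_sq (c := -a) (K := (ε ^ 2)⁻¹ * E - E) (by linarith)
      (fun x hx => by linarith [hL (-x) (by linarith)]) h.integrable.comp_neg.integrableOn
    simpa using this)
  have ha1 := (strictMono_scaledAngle hk).monotone (h.angle_nonneg hV a)
  have ha2 := (strictMono_scaledAngle hk).monotone
    (h.left a fun y hy => hEc.trans (hL y hy)).2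
  have hb0 := h.right b fun y hy => hEc.trans (hR y hy)
  have hb1 := (strictMono_scaledAngle hk).monotone
    (show Real.pi / 2 ≤ θ b by have := hb0.1; push_cast at this; linarith)
  have hb2 := (strictMono_scaledAngle hk).monotone hb0.2
  rw [scaledAngle_zero] at ha1
  rw [scaledAngle_half_pi] at ha2 hb1
  rw [scaledAngle_int_mul_pi, Int.cast_one, one_mul] at hb2
  rw [← Real.sin_pi_sub] at hb
  -- Jordan's inequality `2y/π ≤ sin y`.
  have bound : ∀ y, 0 ≤ y → y ≤ Real.pi / 2 → Real.sin y ≤ ε → y ≤ Real.pi / 2 * ε := by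
    intro y hy0 hy1 hy
    have h2 := (Real.mul_le_sin hy0 hy1).trans hy
    rw [div_mul_eq_mul_div, div_le_iff₀ hπ] at h2
    linarith
  have ha3 := bound _ ha1 ha2 ha
  have hb3 := bound _ (by linarith) (by linarith) hb
  rw [hvol]
  linarith

end IsBoundState

/-! ### Mollification: compactly supported `C²` functions lie in the closure -/

open scoped Convolution

/-- Dominated convergence in `L²`. -/
theorem tendsto_toLp_of_dominated {f : ℕ → ℝ → ℂ} {g : ℝ → ℂ} {G : ℝ → ℝ}
    (hG : MemLp G 2 volume) (hf : ∀ n, MemLp (f n) 2 volume) (hg : MemLp g 2 volume)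
    (hb : ∀ n x, ‖f n x‖ ≤ G x) (hlim : ∀ x, Tendsto (fun n => f n x) atTop (𝓝 (g x))) :
    Tendsto (fun n => (hf n).toLp (f n)) atTop (𝓝 (hg.toLp g)) := by
  have hnorm : ∀ n, ‖(hf n).toLp (f n) - hg.toLp g‖ ^ 2 = ∫ x, ‖f n x - g x‖ ^ 2 := by
    intro n
    rw [← MemLp.toLp_sub, ← RCLike.ofReal_inj (K := ℂ)]
    push_cast
    rw [← inner_self_eq_norm_sq_to_K (𝕜 := ℂ), L2.inner_def]
    refine (integral_congr_ae ?_).trans integral_ofReal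
    filter_upwards [((hf n).sub hg).coeFn_toLp] with x hx
    rw [hx, inner_self_eq_norm_sq_to_K]
    simp
  have hle : ∀ x, ‖g x‖ ≤ G x := fun x =>
    le_of_tendsto (hlim x).norm (Eventually.of_forall fun n => hb n x)
  have h0 : Tendsto (fun n => ∫ x, ‖f n x - g x‖ ^ 2) atTop (𝓝 (∫ _ : ℝ, (0 : ℝ))) := by
    refine tendsto_integral_of_dominated_convergence (fun x => 4 * G x ^ 2) (fun n => ?_)
      (hG.integrable_sq.const_mul 4) (fun n => Eventually.of_forall fun x => ?_)
      (Eventually.of_forall fun x => ?_)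
    · exact (((hf n).sub hg).aestronglyMeasurable.norm.pow 2)
    · rw [Real.norm_of_nonneg (by positivity)]
      have h1 := norm_sub_le (f n x) (g x)
      have h2 := hb n x
      have h3 := hle x
      have h4 := norm_nonneg (f n x - g x)
      nlinarith
    · have := ((hlim x).sub_const (g x)).norm.pow 2
      simpa using this
  rw [tendsto_iff_norm_sub_tendsto_zero]
  have h1 : Tendsto (fun n => Real.sqrt (‖(hf n).toLp (f n) - hg.toLp g‖ ^ 2)) atTop (𝓝 0) := by
    simp only [hnorm]
    simpa [Function.comp_def] using (Real.continuous_sqrt.tendsto _).comp h0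
  simpa [Real.sqrt_sq] using h1

/-- A sequence of bump functions shrinking to the origin. -/
noncomputable def shrinkingBump (n : ℕ) : ContDiffBump (0 : ℝ) where
  rIn := 1 / (2 * ((n : ℝ) + 1))
  rOut := 1 / ((n : ℝ) + 1)
  rIn_pos := by positivity
  rIn_lt_rOut := by
    have : (0 : ℝ) < (n : ℝ) + 1 := by positivity
    gcongr
    linarith

/-- Mollification of `g` at scale `1 / (n + 1)`. -/
noncomputable def mollify (n : ℕ) (g : ℝ → ℂ) : ℝ → ℂ :=
  (shrinkingBump n).normed volume ⋆[ContinuousLinearMap.lsmul ℝ ℝ, volume] g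

theorem tendsto_mollify {g : ℝ → ℂ} (hg : Continuous g) (x : ℝ) :
    Tendsto (fun n => mollify n g x) atTop (𝓝 (g x)) :=
  ContDiffBump.convolution_tendsto_right_of_continuous
    (φ := shrinkingBump) tendsto_one_div_add_atTop_nhds_zero_nat hg x

theorem exists_mollify_bound {g : ℝ → ℂ} (hg : Continuous g) (hgc : HasCompactSupport g) :
    ∃ C R : ℝ, 0 ≤ C ∧ ∀ n x, ‖mollify n g x‖ ≤ (Set.Icc (-R) R).indicator (fun _ => C) x := by
  obtain ⟨C, hC⟩ := hg.bounded_above_of_compact_support hgc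
  have hC0 : 0 ≤ C := (norm_nonneg _).trans (hC 0)
  obtain ⟨R, hR⟩ := hgc.isCompact.isBounded.subset_closedBall 0
  have hz : ∀ x, R < |x| → g x = 0 := by
    intro x hx
    refine image_eq_zero_of_notMem_tsupport fun h => ?_
    have := hR h
    rw [mem_closedBall_zero_iff, Real.norm_eq_abs] at this
    linarith
  have hout : ∀ n, (shrinkingBump n).rOut ≤ 1 := fun n => by
    have : (0 : ℝ) ≤ n := by positivity
    simp only [shrinkingBump]
    rw [div_le_one (by positivity)]
    linarith
  -- The mollified value differs from `g x` by at most the oscillation `2C`, and the support grows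
  -- by at most the largest radius `1`.
  refine ⟨3 * C, R + 1, by positivity, fun n x => ?_⟩
  by_cases hx : x ∈ Set.Icc (-(R + 1)) (R + 1)
  · rw [Set.indicator_of_mem hx]
    have h := (shrinkingBump n).dist_normed_convolution_le (μ := volume) (x₀ := x) (g := g)
      (ε := 2 * C) hg.aestronglyMeasurable fun y _ => by
        rw [dist_eq_norm]
        linarith [norm_sub_le (g y) (g x), hC x, hC y]
    rw [dist_eq_norm] at h
    have h2 := norm_le_norm_add_norm_sub' (mollify n g x) (g x)
    have h3 : ‖mollify n g x - g x‖ ≤ 2 * C := h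
    linarith [hC x]
  · rw [Set.indicator_of_notMem hx]
    have hx' : R + 1 < |x| := by
      by_contra! h
      exact hx (abs_le.1 h)
    have h := (shrinkingBump n).dist_normed_convolution_le (μ := volume) (x₀ := x) (g := g)
      (ε := 0) hg.aestronglyMeasurable fun y hy => by
        have hy' : |y - x| < 1 := by
          rw [Metric.mem_ball, Real.dist_eq] at hy
          exact hy.trans_le (hout n)
        have hyR : R < |y| := by
          have := abs_sub_abs_le_abs_sub x y
          rw [abs_sub_comm] at this
          linarith
        rw [hz y hyR, hz x (by linarith), dist_self]
    rw [hz x (by linarith), dist_zero_right] at h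
    exact h

theorem isTestFunction_mollify (n : ℕ) {g : ℝ → ℂ} (hg : Continuous g)
    (hgc : HasCompactSupport g) : IsTestFunction (mollify n g) :=
  ⟨(shrinkingBump n).hasCompactSupport_normed.contDiff_convolution_left _
      (shrinkingBump n).contDiff_normed hg.locallyIntegrable,
    (shrinkingBump n).hasCompactSupport_normed.convolution _ hgc⟩

theorem deriv_mollify (n : ℕ) {g g' : ℝ → ℂ} (hg : ∀ x, HasDerivAt g (g' x) x)
    (hg' : Continuous g') (hgc : HasCompactSupport g) : deriv (mollify n g) = mollify n g' := by
  have e : deriv g = g' := funext fun x => (hg x).deriv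
  have hC : ContDiff ℝ 1 g := contDiff_one_iff_deriv.2
    ⟨fun x => (hg x).differentiableAt, by rwa [e]⟩
  funext x
  have := hgc.hasDerivAt_convolution_right (ContinuousLinearMap.lsmul ℝ ℝ) (μ := volume)
    (f₀ := (shrinkingBump n).normed volume)
    (hf := (shrinkingBump n).continuous_normed.locallyIntegrable) hC x
  rw [e] at this
  exact this.deriv

/-- A compactly supported `C²` function with given first and second derivatives. -/
structure IsC2Compact (y y' y'' : ℝ → ℂ) : Prop where
  deriv_fst : ∀ x, HasDerivAt y (y' x) x
  deriv_snd : ∀ x, HasDerivAt y' (y'' x) x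
  continuous : Continuous y''
  hasCompactSupport : HasCompactSupport y

namespace IsC2Compact

variable {y y' y'' : ℝ → ℂ}

theorem continuous_zero (h : IsC2Compact y y' y'') : Continuous y :=
  continuous_iff_continuousAt.2 fun x => (h.deriv_fst x).continuousAt

theorem continuous_one (h : IsC2Compact y y' y'') : Continuous y' :=
  continuous_iff_continuousAt.2 fun x => (h.deriv_snd x).continuousAt

theorem hasCompactSupport_one (h : IsC2Compact y y' y'') : HasCompactSupport y' := by
  rw [← funext fun x => (h.deriv_fst x).deriv]
  exact h.hasCompactSupport.deriv

theorem hasCompactSupport_two (h : IsC2Compact y y' y'') : HasCompactSupport y'' := by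
  rw [← funext fun x => (h.deriv_snd x).deriv]
  exact h.hasCompactSupport_one.deriv

theorem conj (h : IsC2Compact y y' y'') :
    IsC2Compact (fun x => starRingEnd ℂ (y x)) (fun x => starRingEnd ℂ (y' x))
      (fun x => starRingEnd ℂ (y'' x)) where
  deriv_fst x := (Complex.conjCLE.hasFDerivAt (x := y x)).comp_hasDerivAt x (h.deriv_fst x)
  deriv_snd x := (Complex.conjCLE.hasFDerivAt (x := y' x)).comp_hasDerivAt x (h.deriv_snd x)
  continuous := Complex.continuous_conj.comp h.continuous
  hasCompactSupport := h.hasCompactSupport.comp_left (g := starRingEnd ℂ) (by simp)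

theorem memLp (h : IsC2Compact y y' y'') : MemLp y 2 volume :=
  h.continuous_zero.memLp_of_hasCompactSupport h.hasCompactSupport

theorem memLp_expr {V : ℝ → ℝ} (hV : Continuous V) (h : IsC2Compact y y' y'') :
    MemLp (fun x => -y'' x + (V x : ℂ) * y x) 2 volume := by
  have h1 := h.continuous_zero
  have h2 := h.continuous
  exact Continuous.memLp_of_hasCompactSupport (by fun_prop)
    (h.hasCompactSupport_two.neg.add (h.hasCompactSupport.mul_left (f := fun x => (V x : ℂ))))

/-- Compactly supported `C²` functions belong to the domain of the closure. -/
theorem mem_closure {V : ℝ → ℝ} (hV : Continuous V) (h : IsC2Compact y y' y'') :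
    (h.memLp.toLp y, (h.memLp_expr hV).toLp (fun x => -y'' x + (V x : ℂ) * y x))
      ∈ (minimalGraph V).topologicalClosure := by
  have ht : ∀ n, IsTestFunction (mollify n y) := fun n =>
    isTestFunction_mollify n h.continuous_zero h.hasCompactSupport
  have hd : ∀ n, deriv (deriv (mollify n y)) = mollify n y'' := fun n => by
    rw [deriv_mollify n h.deriv_fst h.continuous_one h.hasCompactSupport,
      deriv_mollify n h.deriv_snd h.continuous h.hasCompactSupport_one]
  obtain ⟨C, R, hC0, hC⟩ := exists_mollify_bound h.continuous_zero h.hasCompactSupport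
  obtain ⟨D, S, hD0, hD⟩ := exists_mollify_bound h.continuous h.hasCompactSupport_two
  obtain ⟨M, hM⟩ := isCompact_Icc.exists_bound_of_continuousOn (s := Set.Icc (-R) R)
    hV.continuousOn
  have hmem : ∀ (R C : ℝ), MemLp ((Set.Icc (-R) R).indicator fun _ => C) 2 volume := fun R C =>
    memLp_indicator_const 2 measurableSet_Icc C (Or.inr (by simp))
  refine mem_closure_of_tendsto (f := fun n => _) (b := atTop) (Tendsto.prodMk_nhds
    (tendsto_toLp_of_dominated (f := fun n => mollify n y) (hmem R C)
      (fun n => (ht n).1.continuous.memLp_of_hasCompactSupport (ht n).2) h.memLp hC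
      (tendsto_mollify h.continuous_zero))
    (tendsto_toLp_of_dominated (f := fun n => schrodingerExpr V (mollify n y))
      ((hmem S D).add (hmem R (M * C)))
      (fun n => ((ht n).continuous_schrodingerExpr hV).memLp_of_hasCompactSupport
        ((ht n).hasCompactSupport_schrodingerExpr V)) (h.memLp_expr hV) ?_ ?_))
    (Eventually.of_forall fun n => (ht n).mem_minimalGraph hV)
  · intro n x
    simp only [schrodingerExpr, hd, Pi.add_apply]
    refine (norm_add_le _ _).trans (add_le_add ?_ ?_)
    · rw [norm_neg]
      exact hD n x
    · rw [norm_mul, Complex.norm_real]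
      have h1 := hC n x
      by_cases hx : x ∈ Set.Icc (-R) R
      · rw [Set.indicator_of_mem hx] at h1 ⊢
        have := hM x hx
        have h3 : 0 ≤ M := (norm_nonneg _).trans this
        gcongr
      · rw [Set.indicator_of_notMem hx] at h1 ⊢
        rw [le_antisymm h1 (norm_nonneg _), mul_zero]
  · intro x
    simp only [schrodingerExpr, hd]
    exact (tendsto_mollify h.continuous x).neg.add
      ((tendsto_mollify h.continuous_zero x).const_mul _)

end IsC2Compact

/-! ### Square-integrable solutions lie in the closure -/

/-- A smooth cutoff, equal to one near the origin and supported in `[-2, 2]`. -/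
noncomputable def unitCutoff : ContDiffBump (0 : ℝ) := ⟨1, 2, one_pos, one_lt_two⟩

/-- Square-integrable solutions of the eigenvalue equation lie in the closure of the minimal
graph. -/
theorem IsSolution.mem_closure {V : ℝ → ℝ} (hV : IsSingleWell V) {E : ℝ} {u v : ℝ → ℝ}
    (h : IsSolution V E u v) (hu : Integrable fun x => u x ^ 2) {f : L2Line}
    (hf : (f : ℝ → ℂ) =ᵐ[volume] fun x => (u x : ℂ)) :
    (f, (E : ℂ) • f) ∈ (minimalGraph V).topologicalClosure := by
  have hVc := hV.continuous
  have cu := h.continuous_fst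
  have cv := h.continuous_snd
  have hu2 : MemLp u 2 volume := (memLp_two_iff_integrable_sq cu.aestronglyMeasurable).2 hu
  have hv2 : MemLp v 2 volume :=
    (memLp_two_iff_integrable_sq cv.aestronglyMeasurable).2 (h.integrable_snd hV hu)
  set χ : ℝ → ℝ := fun x => unitCutoff x with hχ
  have χs : ContDiff ℝ 2 χ := unitCutoff.contDiff
  have χc : HasCompactSupport χ := unitCutoff.hasCompactSupport
  have χd : ∀ x, HasDerivAt χ (deriv χ x) x := fun x =>
    ((χs.differentiable (by norm_num)) x).hasDerivAt
  have χs1 : ContDiff ℝ 1 (deriv χ) :=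
    ((contDiff_succ_iff_deriv (n := 1)).1 (by norm_num; exact χs)).2.2
  have χdd : ∀ x, HasDerivAt (deriv χ) (deriv (deriv χ) x) x := fun x =>
    ((χs1.differentiable (by norm_num)) x).hasDerivAt
  have χc2 : Continuous (deriv (deriv χ)) := χs1.continuous_deriv le_rfl
  obtain ⟨C₁, hC₁⟩ := χs1.continuous.bounded_above_of_compact_support χc.deriv
  obtain ⟨C₂, hC₂⟩ := χc2.bounded_above_of_compact_support χc.deriv.deriv
  have hχ1 : ∀ x, |χ x| ≤ 1 := fun x => by
    rw [abs_of_nonneg unitCutoff.nonneg]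
    exact unitCutoff.le_one
  set s : ℕ → ℝ := fun n => 1 / ((n : ℝ) + 1) with hs
  have hs0 : ∀ n, 0 < s n := fun n => by simp only [hs]; positivity
  have hs1 : ∀ n, s n ≤ 1 := fun n => by
    simp only [hs]
    rw [div_le_one (by positivity)]
    linarith [(Nat.cast_nonneg n : (0 : ℝ) ≤ n)]
  have hslim : Tendsto s atTop (𝓝 0) := tendsto_one_div_add_atTop_nhds_zero_nat
  -- The cutoff is `χ (s n * x)`: each derivative falling on it costs a factor `s n`, which tends to
  -- `0`.
  have hsd : ∀ n x, HasDerivAt (fun x => s n * x) (s n) x := fun n x => by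
    simpa using (hasDerivAt_id x).const_mul (s n)
  have hy : ∀ n, IsC2Compact (fun x => ((χ (s n * x) * u x : ℝ) : ℂ))
      (fun x => ((s n * deriv χ (s n * x) * u x + χ (s n * x) * v x : ℝ) : ℂ))
      (fun x => ((s n ^ 2 * deriv (deriv χ) (s n * x) * u x + 2 * (s n * deriv χ (s n * x) * v x)
        + χ (s n * x) * ((V x - E) * u x) : ℝ) : ℂ)) := by
    intro n
    refine ⟨fun x => ?_, fun x => ?_, ?_, ?_⟩
    · refine HasDerivAt.ofReal_comp ?_
      convert! ((χd (s n * x)).comp x (hsd n x)).mul (h.deriv_fst x) using 1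
      simp only [Function.comp]
      ring
    · refine HasDerivAt.ofReal_comp ?_
      convert! ((((χdd (s n * x)).comp x (hsd n x)).const_mul (s n)).mul (h.deriv_fst x)).add
        (((χd (s n * x)).comp x (hsd n x)).mul (h.deriv_snd x)) using 1
      simp only [Function.comp]
      ring
    · have := χs1.continuous
      have := χs.continuous
      fun_prop
    · refine HasCompactSupport.comp_left (g := fun y : ℝ => (y : ℂ)) ?_ (by simp)
      exact (χc.comp_homeomorph (Homeomorph.mulLeft₀ (s n) (hs0 n).ne')).mul_right
  have hux : MemLp (fun x => (u x : ℂ)) 2 volume := hu2.ofReal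
  have hf1 : f = hux.toLp _ := Lp.ext (hf.trans hux.coeFn_toLp.symm)
  have hux2 : MemLp (fun x => (E : ℂ) * (u x : ℂ)) 2 volume := hux.const_mul _
  have hf2 : (E : ℂ) • f = hux2.toLp _ := by
    rw [hf1, ← MemLp.toLp_const_smul]
    rfl
  have hχlim : ∀ x, Tendsto (fun n => χ (s n * x)) atTop (𝓝 1) := by
    intro x
    have h1 : χ 0 = 1 := unitCutoff.one_of_mem_closedBall
      (by simp [unitCutoff])
    rw [← h1]
    refine (χs.continuous.tendsto 0).comp ?_
    simpa using hslim.mul_const x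
  have hzero : ∀ {g : ℝ → ℝ}, Continuous g → ∀ x,
      Tendsto (fun n => s n * g (s n * x)) atTop (𝓝 0) := by
    intro g hg x
    have h1 : Tendsto (fun n => g (s n * x)) atTop (𝓝 (g (0 * x))) :=
      (hg.tendsto _).comp (hslim.mul_const x)
    simpa using hslim.mul h1
  rw [hf2, hf1]
  refine _root_.isClosed_closure.mem_of_tendsto (f := fun n => _) (b := atTop) (Tendsto.prodMk_nhds
    (tendsto_toLp_of_dominated hu2.norm (fun n => (hy n).memLp) hux (fun n x => ?_)
      (fun x => ?_))
    (tendsto_toLp_of_dominated (((hu2.norm.const_mul (C₂ + |E|))).add (hv2.norm.const_mul (2 * C₁)))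
      (fun n => (hy n).memLp_expr hVc) hux2 (fun n x => ?_) (fun x => ?_)))
    (Eventually.of_forall fun n => (hy n).mem_closure hVc)
  · rw [Complex.norm_real, norm_mul, Real.norm_eq_abs]
    exact mul_le_of_le_one_left (norm_nonneg _) (hχ1 _)
  · refine (Complex.continuous_ofReal.tendsto _).comp ?_
    simpa using (hχlim x).mul_const (u x)
  -- The terms with `V` cancel because `u` solves the equation, so `|u|` and `|v|` alone dominate;
  -- `V u` is never estimated.
  · have e : (-((s n ^ 2 * deriv (deriv χ) (s n * x) * u x + 2 * (s n * deriv χ (s n * x) * v x)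
        + χ (s n * x) * ((V x - E) * u x) : ℝ) : ℂ) + (V x : ℂ) * ((χ (s n * x) * u x : ℝ) : ℂ))
        = ((E * χ (s n * x) * u x - s n ^ 2 * deriv (deriv χ) (s n * x) * u x
          - 2 * (s n * deriv χ (s n * x) * v x) : ℝ) : ℂ) := by
      push_cast
      ring
    rw [e, Complex.norm_real]
    simp only [Pi.add_apply, Real.norm_eq_abs]
    have hsn : s n ^ 2 ≤ 1 := pow_le_one₀ (hs0 n).le (hs1 n)
    have a1 : |E * χ (s n * x) * u x| ≤ |E| * |u x| := by
      rw [abs_mul, abs_mul]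
      have := hχ1 (s n * x)
      have h0 := abs_nonneg E
      have h1 := abs_nonneg (u x)
      have : |E| * |χ (s n * x)| ≤ |E| * 1 := by gcongr
      nlinarith
    have a2 : |s n ^ 2 * deriv (deriv χ) (s n * x) * u x| ≤ C₂ * |u x| := by
      rw [abs_mul, abs_mul, abs_of_nonneg (sq_nonneg (s n))]
      have h0 := hC₂ (s n * x)
      rw [Real.norm_eq_abs] at h0
      have : s n ^ 2 * |deriv (deriv χ) (s n * x)| ≤ 1 * C₂ := by gcongr
      rw [one_mul] at this
      gcongr
    have a3 : |2 * (s n * deriv χ (s n * x) * v x)| ≤ 2 * C₁ * |v x| := by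
      rw [abs_mul, abs_mul, abs_mul, abs_of_pos (hs0 n), abs_two]
      have h0 := hC₁ (s n * x)
      rw [Real.norm_eq_abs] at h0
      have : s n * |deriv χ (s n * x)| ≤ 1 * C₁ := by
        have := hs1 n
        gcongr
      have := mul_le_mul_of_nonneg_right this (abs_nonneg (v x))
      linarith
    have t1 := abs_sub (E * χ (s n * x) * u x - s n ^ 2 * deriv (deriv χ) (s n * x) * u x)
      (2 * (s n * deriv χ (s n * x) * v x))
    have t2 := abs_sub (E * χ (s n * x) * u x) (s n ^ 2 * deriv (deriv χ) (s n * x) * u x)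
    linarith
  · have e : ∀ n, (-((s n ^ 2 * deriv (deriv χ) (s n * x) * u x
        + 2 * (s n * deriv χ (s n * x) * v x)
        + χ (s n * x) * ((V x - E) * u x) : ℝ) : ℂ) + (V x : ℂ) * ((χ (s n * x) * u x : ℝ) : ℂ))
        = ((E * u x * χ (s n * x) - s n * (s n * deriv (deriv χ) (s n * x)) * u x
          - 2 * (s n * deriv χ (s n * x)) * v x : ℝ) : ℂ) := by
      intro n
      push_cast
      ring
    simp only [e]
    rw [← Complex.ofReal_mul]
    refine (Complex.continuous_ofReal.tendsto _).comp ?_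
    have := (((hχlim x).const_mul (E * u x)).sub ((hslim.mul (hzero χc2 x)).mul_const (u x))).sub
      (((hzero χs1.continuous x).const_mul 2).mul_const (v x))
    simpa using this

/-! ### Symmetry of the closure and regularity of eigenfunctions -/

theorem IsTestFunction.isC2Compact {φ : ℝ → ℂ} (h : IsTestFunction φ) :
    IsC2Compact φ (deriv φ) (deriv (deriv φ)) where
  deriv_fst x := (h.differentiable x).hasDerivAt
  deriv_snd x := (h.derivTest.differentiable x).hasDerivAt
  continuous := h.derivTest.derivTest.1.continuous
  hasCompactSupport := h.2

theorem IsTestFunction.conj {φ : ℝ → ℂ} (h : IsTestFunction φ) :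
    IsTestFunction fun x => starRingEnd ℂ (φ x) :=
  ⟨Complex.conjCLE.contDiff.comp h.1, h.2.comp_left (g := starRingEnd ℂ) (by simp)⟩

theorem schrodingerExpr_conj (V : ℝ → ℝ) {φ : ℝ → ℂ} (h : IsTestFunction φ) (x : ℝ) :
    schrodingerExpr V (fun x => starRingEnd ℂ (φ x)) x
      = starRingEnd ℂ (schrodingerExpr V φ x) := by
  have h1 : deriv (fun x => starRingEnd ℂ (φ x)) = fun x => starRingEnd ℂ (deriv φ x) :=
    funext fun x => (h.isC2Compact.conj.deriv_fst x).deriv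
  have h2 : deriv (fun x => starRingEnd ℂ (deriv φ x)) =
      fun x => starRingEnd ℂ (deriv (deriv φ) x) :=
    funext fun x => (h.isC2Compact.conj.deriv_snd x).deriv
  simp [schrodingerExpr, h1, h2]

/-- The closure of the minimal operator is symmetric. -/
theorem inner_eq_of_mem_closure {V : ℝ → ℝ} (hV : Continuous V) {p q : L2Line × L2Line}
    (hp : p ∈ (minimalGraph V).topologicalClosure) (hq : q ∈ (minimalGraph V).topologicalClosure) :
    inner ℂ q.1 p.2 = inner ℂ q.2 p.1 := by
  have h0 : ∀ p ∈ minimalGraph V, ∀ q ∈ minimalGraph V, inner ℂ q.1 p.2 = inner ℂ q.2 p.1 := by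
    rintro p ⟨φ, h, hp1, hp2⟩ q ⟨χ, k, hq1, hq2⟩
    have e := h.integral_schrodingerExpr hV k.conj
    rw [L2.inner_def, L2.inner_def]
    refine (integral_congr_ae ?_).trans (e.symm.trans (integral_congr_ae ?_))
    · filter_upwards [hp2, hq1] with x h1 h2
      rw [h1, h2, RCLike.inner_apply, mul_comm]
    · filter_upwards [hp1, hq2] with x h1 h2
      rw [h1, h2, RCLike.inner_apply, schrodingerExpr_conj V k, mul_comm]
  have h1 : ∀ p ∈ (minimalGraph V).topologicalClosure, ∀ q ∈ minimalGraph V,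
      inner ℂ q.1 p.2 = inner ℂ q.2 p.1 := fun p hp q hq =>
    closure_minimal (t := {p : L2Line × L2Line | inner ℂ q.1 p.2 = inner ℂ q.2 p.1})
      (fun p hp => h0 p hp q hq) (isClosed_eq (by fun_prop) (by fun_prop)) hp
  exact closure_minimal (t := {q : L2Line × L2Line | inner ℂ q.1 p.2 = inner ℂ q.2 p.1})
    (fun q hq => h1 p hp q hq) (isClosed_eq (by fun_prop) (by fun_prop)) hq

/-- Weak form of the eigenvalue equation, tested against compactly supported `C²` functions. -/
theorem IsC2Compact.integral_eq {V : ℝ → ℝ} (hV : Continuous V) {y y' y'' : ℝ → ℂ}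
    (h : IsC2Compact y y' y'') {E : ℝ} {f : L2Line}
    (hf : (f, (E : ℂ) • f) ∈ (minimalGraph V).topologicalClosure) :
    ∫ x, (-y'' x + (V x : ℂ) * y x - E * y x) * f x = 0 := by
  have e := inner_eq_of_mem_closure hV hf (h.conj.mem_closure hV)
  simp only at e
  have e2 : inner ℂ ((h.conj.memLp_expr hV).toLp _ - (E : ℂ) • h.conj.memLp.toLp _) f = 0 := by
    rw [inner_sub_left, inner_smul_left, Complex.conj_ofReal, ← e, inner_smul_right, sub_self]
  rw [L2.inner_def] at e2
  rw [← e2]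
  refine integral_congr_ae ?_
  filter_upwards [(h.conj.memLp_expr hV).coeFn_toLp, h.conj.memLp.coeFn_toLp,
    Lp.coeFn_sub ((h.conj.memLp_expr hV).toLp _) ((E : ℂ) • h.conj.memLp.toLp _),
    Lp.coeFn_smul (E : ℂ) (h.conj.memLp.toLp _)] with x h1 h2 h3 h4
  rw [h3, Pi.sub_apply, h4, Pi.smul_apply, h1, h2]
  simp [mul_comm]

theorem integral_eq_zero_of_lt {g : ℝ → ℂ} {R x : ℝ} (hg : ∀ z, R < |z| → g z = 0)
    (hx : x < -R) : ∫ t in (-R)..x, g t = 0 := by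
  refine (intervalIntegral.integral_congr_ae (g := fun _ => (0 : ℂ)) ?_).trans (by simp)
  have : ∀ᵐ t : ℝ, t ≠ -R := by simp [ae_iff]
  filter_upwards [this] with t ht htm
  rw [Set.uIoc_of_ge hx.le] at htm
  refine hg t ?_
  have : t < -R := lt_of_le_of_ne htm.2 ht
  exact lt_of_lt_of_le (by linarith) (neg_le_abs t)

theorem integral_eq_of_gt {g : ℝ → ℂ} {R x : ℝ} (hg : ∀ z, R < |z| → g z = 0)
    (hR : 0 ≤ R) (hx : R < x) : ∫ t in (-R)..x, g t = ∫ t, g t := by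
  rw [intervalIntegral.integral_of_le (by linarith)]
  have h1 : Set.Ioc (-R) x =ᵐ[volume] Set.Icc (-R) x := Ioc_ae_eq_Icc
  rw [setIntegral_congr_set h1]
  refine setIntegral_eq_integral_of_forall_compl_eq_zero fun t ht => hg t ?_
  by_contra! h
  have := abs_le.1 h
  exact ht ⟨this.1, by linarith [this.2]⟩

/-- Solvability of the inhomogeneous equation with a compactly supported solution. -/
theorem exists_isC2Compact_of_orthogonal {V : ℝ → ℝ} (hV : Continuous V) {E : ℝ}
    {u₁ v₁ u₂ v₂ : ℝ → ℝ} (h₁ : IsSolution V E u₁ v₁) (h₂ : IsSolution V E u₂ v₂)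
    (hW : ∀ x, u₁ x * v₂ x - v₁ x * u₂ x = 1) {g : ℝ → ℂ} (hg : Continuous g)
    (hgc : HasCompactSupport g) (hg1 : ∫ x, (u₁ x : ℂ) * g x = 0)
    (hg2 : ∫ x, (u₂ x : ℂ) * g x = 0) :
    ∃ y y' y'' : ℝ → ℂ, IsC2Compact y y' y'' ∧
      ∀ x, -y'' x + (V x : ℂ) * y x - E * y x = -g x := by
  have c1 := h₁.continuous_fst
  have c2 := h₂.continuous_fst
  have c3 := h₁.continuous_snd
  have c4 := h₂.continuous_snd
  obtain ⟨R, hR0, hR⟩ : ∃ R : ℝ, 0 ≤ R ∧ ∀ z, R < |z| → g z = 0 := by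
    obtain ⟨R, hR⟩ := hgc.isCompact.isBounded.subset_closedBall 0
    refine ⟨max R 0, le_max_right _ _, fun z hz => image_eq_zero_of_notMem_tsupport fun h => ?_⟩
    have := hR h
    rw [mem_closedBall_zero_iff, Real.norm_eq_abs] at this
    linarith [le_max_left R 0]
  have hz : ∀ (u : ℝ → ℝ), (∫ x, (u x : ℂ) * g x = 0) → ∀ x, R < |x| →
      ∫ t in (-R)..x, (u t : ℂ) * g t = 0 := by
    intro u hu x hx
    have h0 : ∀ z, R < |z| → (u z : ℂ) * g z = 0 := fun z hz => by rw [hR z hz, mul_zero]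
    rcases lt_abs.1 hx with h | h
    · rw [integral_eq_of_gt h0 hR0 h, hu]
    · exact integral_eq_zero_of_lt h0 (by linarith)
  -- Variation of constants: `A` and `B` vanish to the left of the support of `g` by the choice of
  -- base point, and to its right by orthogonality.
  set A : ℝ → ℂ := fun x => ∫ t in (-R)..x, (u₁ t : ℂ) * g t with hA
  set B : ℝ → ℂ := fun x => ∫ t in (-R)..x, (u₂ t : ℂ) * g t with hB
  have dA : ∀ x, HasDerivAt A ((u₁ x : ℂ) * g x) x := fun x =>
    (Continuous.integral_hasStrictDerivAt (by fun_prop) (-R) x).hasDerivAt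
  have dB : ∀ x, HasDerivAt B ((u₂ x : ℂ) * g x) x := fun x =>
    (Continuous.integral_hasStrictDerivAt (by fun_prop) (-R) x).hasDerivAt
  have cA : Continuous A := continuous_iff_continuousAt.2 fun x => (dA x).continuousAt
  have cB : Continuous B := continuous_iff_continuousAt.2 fun x => (dB x).continuousAt
  have hWc : ∀ x, (u₁ x : ℂ) * v₂ x - v₁ x * u₂ x = 1 := fun x => by exact_mod_cast hW x
  refine ⟨fun x => u₂ x * A x - u₁ x * B x, fun x => v₂ x * A x - v₁ x * B x,
    fun x => (V x - E : ℂ) * (u₂ x * A x - u₁ x * B x) + g x,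
    ⟨fun x => ?_, fun x => ?_, by fun_prop, ?_⟩, fun x => by ring⟩
  · convert! ((h₂.deriv_fst x).ofReal_comp.mul (dA x)).sub
      ((h₁.deriv_fst x).ofReal_comp.mul (dB x)) using 1
    ring
  · convert! ((h₂.deriv_snd x).ofReal_comp.mul (dA x)).sub
      ((h₁.deriv_snd x).ofReal_comp.mul (dB x)) using 1
    push_cast
    linear_combination (-g x) * hWc x
  · refine HasCompactSupport.intro (isCompact_closedBall (0 : ℝ) R) fun x hx => ?_
    rw [mem_closedBall_zero_iff, Real.norm_eq_abs, not_le] at hx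
    simp [hA, hB, hz u₁ hg1 x hx, hz u₂ hg2 x hx]

/-- The space of test functions. -/
def testSubmodule : Submodule ℂ (ℝ → ℂ) where
  carrier := {φ | IsTestFunction φ}
  add_mem' := IsTestFunction.add
  zero_mem' := ⟨contDiff_const, HasCompactSupport.zero⟩
  smul_mem' c _ h := h.const_smul c

theorem IsTestFunction.integrable_mul {φ : ℝ → ℂ} (h : IsTestFunction φ) {f : ℝ → ℂ}
    (hf : LocallyIntegrable f) : Integrable fun x => f x * φ x := by
  have := hf.integrable_smul_left_of_hasCompactSupport h.1.continuous h.2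
  simpa [mul_comm] using this

/-- Pairing with a locally integrable function, as a functional on test functions. -/
noncomputable def testPairing (f : ℝ → ℂ) (hf : LocallyIntegrable f) :
    testSubmodule →ₗ[ℂ] ℂ where
  toFun φ := ∫ x, f x * (φ : ℝ → ℂ) x
  map_add' φ χ := by
    rw [← integral_add (φ.2.integrable_mul hf) (χ.2.integrable_mul hf)]
    simp [mul_add]
  map_smul' c φ := by
    rw [RingHom.id_apply, smul_eq_mul, ← integral_const_mul]
    refine integral_congr_ae (Eventually.of_forall fun x => ?_)
    simp
    ring

/-- An eigenfunction of the closure coincides almost everywhere with a classical solution. -/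
theorem exists_linear_comb_of_mem_closure {V : ℝ → ℝ} (hV : Continuous V) {E : ℝ}
    {u₁ v₁ u₂ v₂ : ℝ → ℝ} (h₁ : IsSolution V E u₁ v₁) (h₂ : IsSolution V E u₂ v₂)
    (hW : ∀ x, u₁ x * v₂ x - v₁ x * u₂ x = 1) {f : L2Line}
    (hf : (f, (E : ℂ) • f) ∈ (minimalGraph V).topologicalClosure) :
    ∃ α β : ℂ, (f : ℝ → ℂ) =ᵐ[volume] fun x => α * u₁ x + β * u₂ x := by
  have c1 : Continuous fun x => (u₁ x : ℂ) := Complex.continuous_ofReal.comp h₁.continuous_fst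
  have c2 : Continuous fun x => (u₂ x : ℂ) := Complex.continuous_ofReal.comp h₂.continuous_fst
  have hfl : LocallyIntegrable (f : ℝ → ℂ) := (Lp.memLp f).locallyIntegrable (by norm_num)
  -- A test function orthogonal to `u₁` and `u₂` is in the range of the equation on compactly
  -- supported `C²` functions, hence annihilated by `f`. A functional vanishing on a finite
  -- intersection of kernels is a combination of the corresponding functionals.
  have hspan := mem_span_of_iInf_ker_le_ker
    (L := ![testPairing _ c1.locallyIntegrable, testPairing _ c2.locallyIntegrable])
    (K := testPairing f hfl) (by
      intro g hg
      rw [Submodule.mem_iInf] at hg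
      have hg1 : ∫ x, (u₁ x : ℂ) * (g : ℝ → ℂ) x = 0 := hg 0
      have hg2 : ∫ x, (u₂ x : ℂ) * (g : ℝ → ℂ) x = 0 := hg 1
      obtain ⟨y, y', y'', hy, hyg⟩ := exists_isC2Compact_of_orthogonal hV h₁ h₂ hW
        g.2.1.continuous g.2.2 hg1 hg2
      have := hy.integral_eq hV hf
      simp only [hyg, neg_mul, integral_neg, neg_eq_zero] at this
      rw [LinearMap.mem_ker]
      change ∫ x, f x * (g : ℝ → ℂ) x = 0
      rw [← this]
      simp [mul_comm])
  obtain ⟨c, hc⟩ := (Submodule.mem_span_range_iff_exists_fun ℂ).1 hspan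
  refine ⟨c 0, c 1, ?_⟩
  have hl1 : LocallyIntegrable fun x => c 0 * (u₁ x : ℂ) + c 1 * u₂ x :=
    Continuous.locallyIntegrable (by fun_prop)
  have hz := ae_eq_zero_of_integral_contDiff_smul_eq_zero (hfl.sub hl1) (by
    intro g hg hgc
    have ht : IsTestFunction fun x => (g x : ℂ) :=
      ⟨Complex.ofRealCLM.contDiff.comp hg, hgc.comp_left (g := fun y : ℝ => (y : ℂ)) (by simp)⟩
    have e := congrArg (fun L : testSubmodule →ₗ[ℂ] ℂ => L ⟨_, ht⟩) hc
    simp only [Fin.sum_univ_two, Matrix.cons_val_zero, Matrix.cons_val_one, LinearMap.add_apply,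
      LinearMap.smul_apply, smul_eq_mul] at e
    change c 0 * (∫ x, (u₁ x : ℂ) * (g x : ℂ)) + c 1 * (∫ x, (u₂ x : ℂ) * (g x : ℂ))
      = ∫ x, f x * (g x : ℂ) at e
    have i1 := (ht.integrable_mul c1.locallyIntegrable).const_mul (c 0)
    have i2 := (ht.integrable_mul c2.locallyIntegrable).const_mul (c 1)
    rw [← integral_const_mul, ← integral_const_mul, ← integral_add i1 i2] at e
    have e2 : ∫ x, g x • (f - fun x => c 0 * (u₁ x : ℂ) + c 1 * u₂ x) x
        = ∫ x, (f x * (g x : ℂ) -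
          (c 0 * ((u₁ x : ℂ) * (g x : ℂ)) + c 1 * ((u₂ x : ℂ) * (g x : ℂ)))) := by
      refine integral_congr_ae (Eventually.of_forall fun x => ?_)
      simp only [Pi.sub_apply, Complex.real_smul]
      ring
    rw [e2]
    refine (integral_sub (ht.integrable_mul hfl) (i1.add i2)).trans ?_
    rw [← e]
    exact sub_self _)
  filter_upwards [hz] with x hx
  rwa [Pi.sub_apply, sub_eq_zero] at hx

/-! ### Eigenvalues as bound-state energies, and the theorem -/

/-- Closability identifies the graph of the closure with the closure of the graph, which removes
operator domains from the problem. -/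
theorem mem_schrodingerEigenvalues_iff {V : ℝ → ℝ} (hV : Continuous V) (E : ℝ) :
    E ∈ schrodingerEigenvalues V ↔
      ∃ f : L2Line, f ≠ 0 ∧ (f, (E : ℂ) • f) ∈ (minimalGraph V).topologicalClosure := by
  have hg : (schrodingerOperator V).graph = (minimalGraph V).topologicalClosure := by
    rw [schrodingerOperator, ← (minimalOperator_isClosable hV).graph_closure_eq_closure_graph,
      minimalOperator_graph]
  rw [← hg]
  constructor
  · rintro ⟨ψ, h0, hψ⟩
    refine ⟨ψ, h0, ?_⟩
    rw [← hψ]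
    exact LinearPMap.mem_graph _ ψ
  · rintro ⟨f, h0, hf⟩
    obtain ⟨ψ, h1, h2⟩ := LinearPMap.mem_graph_iff _ |>.1 hf
    simp only at h1 h2
    exact ⟨ψ, by rwa [h1], by rw [h2, h1]⟩

/-- The eigenvalues are exactly the energies of bound states. -/
theorem mem_schrodingerEigenvalues_iff_isBoundState {V : ℝ → ℝ} (hV : IsSingleWell V) (E : ℝ) :
    E ∈ schrodingerEigenvalues V ↔ ∃ (n : ℤ) (θ r : ℝ → ℝ), IsBoundState V E n θ r := by
  rw [mem_schrodingerEigenvalues_iff hV.continuous]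
  constructor
  · rintro ⟨f, h0, hf⟩
    obtain ⟨u₁, v₁, u₂, v₂, h₁, h₂, hW⟩ := exists_fundamental_system hV.continuous E
    obtain ⟨α, β, hαβ⟩ := exists_linear_comb_of_mem_closure hV.continuous h₁ h₂ hW hf
    -- Since `V` and `E` are real, the real and imaginary parts are solutions separately, and at
    -- least one is nontrivial.
    have hre := h₁.linear_comb h₂ α.re β.re
    have him := h₁.linear_comb h₂ α.im β.im
    have hfL := Lp.memLp f
    have hire : Integrable fun x => (α.re * u₁ x + β.re * u₂ x) ^ 2 := by
      refine hfL.re.integrable_sq.congr ?_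
      filter_upwards [hαβ] with x hx
      simp [hx]
    have hiim : Integrable fun x => (α.im * u₁ x + β.im * u₂ x) ^ 2 := by
      refine hfL.im.integrable_sq.congr ?_
      filter_upwards [hαβ] with x hx
      simp [hx]
    by_cases hz : ∃ x, α.re * u₁ x + β.re * u₂ x ≠ 0
    · obtain ⟨x, hx⟩ := hz
      exact hre.exists_isBoundState hV hire hx
    · push Not at hz
      by_cases hw : ∃ x, α.im * u₁ x + β.im * u₂ x ≠ 0
      · obtain ⟨x, hx⟩ := hw
        exact him.exists_isBoundState hV hiim hx
      · push Not at hw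
        refine absurd ?_ h0
        rw [Lp.eq_zero_iff_ae_eq_zero]
        filter_upwards [hαβ] with x hx
        rw [hx]
        apply Complex.ext
        · simpa using hz x
        · simpa using hw x
  · rintro ⟨n, θ, r, h⟩
    have cu := h.solution.continuous_fst
    have hu2 : MemLp (fun x => r x * Real.sin (θ x)) 2 volume :=
      (memLp_two_iff_integrable_sq cu.aestronglyMeasurable).2 h.integrable
    have hux : MemLp (fun x => ((r x * Real.sin (θ x) : ℝ) : ℂ)) 2 volume := hu2.ofReal
    refine ⟨hux.toLp _, fun h0 => ?_, h.solution.mem_closure hV h.integrable hux.coeFn_toLp⟩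
    rw [Lp.eq_zero_iff_ae_eq_zero] at h0
    have hzero := Measure.eq_of_ae_eq (hux.coeFn_toLp.symm.trans h0)
      (Complex.continuous_ofReal.comp cu) continuous_const
    -- If `u` vanished identically, so would `u'`, and sine and cosine of the angle would both be
    -- zero.
    have hsin : ∀ x, Real.sin (θ x) = 0 := fun x => by
      have hx := congrFun hzero x
      simp only [Pi.zero_apply, Complex.ofReal_eq_zero, mul_eq_zero] at hx
      exact hx.resolve_left (h.radius_pos x).ne'
    have hd := (h.solution.deriv_fst 0).unique
      ((hasDerivAt_const (0 : ℝ) (0 : ℝ)).congr_of_eventuallyEq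
        (Eventually.of_forall fun x => by simp [hsin x]))
    have hcos := (mul_eq_zero.1 hd).resolve_left (h.radius_pos 0).ne'
    have := Real.sin_sq_add_cos_sq (θ 0)
    rw [hsin, hcos] at this
    norm_num at this

theorem theorem6p6 (V : ℝ → ℝ) (hV : IsSingleWell V) :
    ∃ E : ℕ+ → ℝ, IsEigenvalueSequence V E ∧
      (∀ ε : ℝ, 0 < ε → ε < 1 →
        4 / 27 * (1 - ε) ^ 3 * Real.pi ≤
          Real.sqrt (E 1) * volume.real {x : ℝ | V x < (ε ^ 2)⁻¹ * E 1}) ∧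
      (∀ n : ℕ+,
        Real.pi * ((n : ℝ) - 1) ≤ Real.sqrt (E n) * volume.real {x : ℝ | V x < E n}) ∧
      (∀ n : ℕ+, ∀ t : ℝ, 0 < t →
        Real.sqrt (E n / (1 + t)) * volume.real {x : ℝ | V x < E n / (1 + t)} ≤
          Real.pi * (n : ℝ) / Real.sqrt t) := by
  choose E θ r h using fun n : ℕ+ => exists_isBoundState hV (n := n) n.pos
  have hmono : StrictMono E := by
    intro m n hmn
    have hmn' : ((m : ℕ) : ℤ) < ((n : ℕ) : ℤ) := by exact_mod_cast hmn
    by_contra! hle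
    rcases hle.lt_or_eq with hlt | heq
    · have := (h n).lt_of_energy_lt hV (h m) hlt
      omega
    · have hm := h m
      rw [← heq] at hm
      exact hmn'.ne (hm.rotation_unique hV (h n))
  have hweyl : ∀ n : ℕ+,
      Real.pi * ((n : ℝ) - 1) ≤ Real.sqrt (E n) * volume.real {x : ℝ | V x < E n} := fun n => by
    simpa using (h n).pi_mul_sub_one_le hV
  refine ⟨E, ⟨hmono, ?_, ?_⟩, fun ε hε hε1 => ?_, hweyl, fun n t ht => ?_⟩
  · ext e
    rw [mem_schrodingerEigenvalues_iff_isBoundState hV]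
    constructor
    · rintro ⟨n, rfl⟩
      exact ⟨_, _, _, h n⟩
    · rintro ⟨n, φ, s, hs⟩
      have hn := hs.one_le hV
      lift n to ℕ using by omega
      have hn' : 0 < n := by omega
      refine ⟨⟨n, hn'⟩, ?_⟩
      rcases lt_trichotomy (E ⟨n, hn'⟩) e with hlt | heq | hgt
      · exact absurd ((h ⟨n, hn'⟩).lt_of_energy_lt hV hs hlt) (by simp)
      · exact heq
      · exact absurd (hs.lt_of_energy_lt hV (h ⟨n, hn'⟩) hgt) (by simp)
  -- If all energies lay below `b`, the second inequality would bound `π(n-1)` by the finite number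
  -- `√b |{V < b}|` for every `n`. Evaluating at `n.succPNat` turns `n - 1` into a plain natural
  -- number.
  · refine tendsto_atTop_atTop_of_monotone hmono.monotone fun b => ?_
    by_contra! hb
    have hb1 : 0 < b := ((h 1).energy_pos hV).trans (hb 1)
    obtain ⟨a, c, -, hL, hR, -, -⟩ := hV.exists_sublevel hb1
    have hsub : {x : ℝ | V x < b} ⊆ Set.Icc a c := fun x hx => by
      have hx' : V x < b := hx
      constructor
      · by_contra! hlt
        linarith [hL x hlt.le]
      · by_contra! hlt
        linarith [hR x hlt.le]
    have hfin : volume {x : ℝ | V x < b} ≠ ⊤ :=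
      ((measure_mono hsub).trans_lt measure_Icc_lt_top).ne
    obtain ⟨n, hn⟩ := exists_nat_gt (Real.sqrt b * volume.real {x : ℝ | V x < b} / Real.pi)
    rw [div_lt_iff₀ Real.pi_pos] at hn
    have h1 := hweyl n.succPNat
    have h2 : volume.real {x : ℝ | V x < E n.succPNat} ≤ volume.real {x : ℝ | V x < b} :=
      measureReal_mono (fun x (hx : V x < _) => hx.trans (hb _)) hfin
    have h3 : Real.sqrt (E n.succPNat) ≤ Real.sqrt b := Real.sqrt_le_sqrt (hb _).le
    have h4 := mul_le_mul h3 h2 measureReal_nonneg (Real.sqrt_nonneg b)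
    simp only [Nat.succPNat_coe, Nat.cast_succ] at h1
    linarith
  · have h1 : IsBoundState V (E 1) 1 (θ 1) (r 1) := by simpa using h 1
    -- The bound `π(1-ε)` exceeds the required one, as `0 < 1 - ε < 1`.
    refine le_trans ?_ (h1.pi_mul_one_sub_le hV hε hε1)
    have h2 : (1 - ε) ^ 2 ≤ 1 := pow_le_one₀ (by linarith) (by linarith)
    have h3 : (1 - ε) ^ 3 ≤ 1 - ε := by
      nlinarith
    have h4 : 4 / 27 * (1 - ε) ^ 3 ≤ 1 - ε := by linarith
    nlinarith [Real.pi_pos]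
  · simpa using (h n).sqrt_mul_volume_le hV ht
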